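/- Let $d\ge 1$ and $\rho\ge 0$, and write $\lambda$ for Lebesgue measure on $\mathbb{R}^d$. The homogeneous Poisson process of density $\rho$ in $\mathbb{R}^d$ is a random locally finite simple point set $\Lambda\subset\mathbb{R}^d$ such that the number of points of $\Lambda$ in a measurable set $A$ of finite volume is Poisson distributed with parameter $\rho\,\lambda(A)$, and such that the numbers of points in finitely many pairwise disjoint measurable sets are independent. For a (possibly signed or complex) Radon measure $\omega$ on $\mathbb{R}^d$, let $\omega_R$ be its restriction to the open ball $B_R$ of radius $R$ around the origin, and let $\widetilde{\omega_R}$ be the measure defined by $\widetilde{\omega_R}(g)=\overline{\omega_R(\tilde g)}$ with $\tilde g(x)=\overline{g(-x)}$. The autocorrelation of $\omega$ is the limit $$\gamma_\omega=\lim_{R\to\infty}\frac{\omega_R*\widetilde{\omega_R}}{\lambda(B_R)}$$ in the vague topology (that is, tested against continuous functions of compact support), if it exists. The diffraction measure $\widehat{\gamma_\omega}$ is the Fourier transform of $\gamma_\omega$ (as a tempered distribution, with the kernel $e^{-2\pi i k\cdot x}$). **Theorem.** For almost every realisation $\Lambda$ of the homogeneous Poisson process of density $\rho$ in $\mathbb{R}^d$,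 the following holds. If $(W_x)_{x\in\Lambda}$ is an i.i.d. family of random variables that take the values $1$ and $-1$ with probability $\tfrac12$ each, then almost surely the random Dirac comb $\omega=\sum_{x\in\Lambda}W_x\,\delta_x$ has an autocorrelation and a diffraction measure, and these are $$\gamma_\omega=\rho\,\delta_0\qquad\text{and}\qquad\widehat{\gamma_\omega}=\rho\,\lambda .$$ -/

import Mathlib

open MeasureTheory ProbabilityTheory Filter Topology
open scoped NNReal ENNReal SchwartzMap FourierTransform ComplexConjugate CompactlySupported

namespace RandomDiffraction

/-- The Euclidean space `ℝ^d`. -/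
abbrev Space (d : ℕ) : Type := EuclideanSpace ℝ (Fin d)

/-! ### Complex Radon measures on `ℝ^d`, their autocorrelation and diffraction -/

/-- A (possibly signed or complex, possibly unbounded) Radon measure on `ℝ^d`, presented as
`density • base` with a positive locally finite measure `base` and a locally `base`-integrable
function `density`. By the polar decomposition `ω = h |ω|` every complex Radon measure has such a
presentation. It is not unique; a measure is identified with the functional `integral` below. -/
structure RadonMeasure (d : ℕ) where
  /-- the positive measure -/
  base : Measure (Space d)
  /-- the complex density relative to the positive measure -/
  density : Space d → ℂ
  isLocallyFinite : IsLocallyFiniteMeasure base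
  locallyIntegrable : LocallyIntegrable density base

namespace RadonMeasure

variable {d : ℕ}

/-- The functional `g ↦ ∫ g dω`. -/
noncomputable def integral (ω : RadonMeasure d) (g : Space d → ℂ) : ℂ :=
  ∫ x, g x * ω.density x ∂ω.base

/-- The total variation measure `|ω|`. -/
noncomputable def variation (ω : RadonMeasure d) : Measure (Space d) :=
  ω.base.withDensity fun x => ‖ω.density x‖ₑ

/-- The restriction of `ω` to a set. -/
noncomputable def restrict (ω : RadonMeasure d) (s : Set (Space d)) : RadonMeasure d where
  base := ω.base.restrict s
  density := ω.density
  isLocallyFinite := by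
    have := ω.isLocallyFinite
    infer_instance
  locallyIntegrable := ω.locallyIntegrable.mono_measure Measure.restrict_le_self

/-- A positive locally finite measure as a Radon measure. -/
noncomputable def ofMeasure (μ : Measure (Space d)) [h : IsLocallyFiniteMeasure μ] :
    RadonMeasure d where
  base := μ
  density := fun _ => 1
  isLocallyFinite := h
  locallyIntegrable := locallyIntegrable_const 1

end RadonMeasure

/-- The flipped-over functional `T̃ (g) = conj (T (g̃))`, where `g̃ x = conj (g (-x))`. -/
noncomputable def functionalFlip {d : ℕ} (T : (Space d → ℂ) → ℂ) : (Space d → ℂ) → ℂ :=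
  fun g => conj (T fun x => conj (g (-x)))

/-- The convolution `(S * T) (g) = ∫∫ g (x + y) dT(y) dS(x)`. -/
def functionalConv {d : ℕ} (S T : (Space d → ℂ) → ℂ) : (Space d → ℂ) → ℂ :=
  fun g => S fun x => T fun y => g (x + y)

/-- `γ` is the autocorrelation of `ω`: as `R → ∞`, the measures `(ω_R * ω̃_R) / vol (B_R)` converge
to `γ` in the vague topology, i.e. tested against continuous functions of compact support. Here
`ω_R` is the restriction of `ω` to the open ball `B_R` of radius `R` around the origin. -/
def IsAutocorrelation {d : ℕ} (ω γ : RadonMeasure d) : Prop :=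
  ∀ g : C_c(Space d, ℂ),
    Tendsto (fun R : ℝ =>
        functionalConv (ω.restrict (Metric.ball 0 R)).integral
            (functionalFlip (ω.restrict (Metric.ball 0 R)).integral) g /
          ((volume (Metric.ball (0 : Space d) R)).toReal : ℂ))
      atTop (𝓝 (γ.integral g))

/-- The positive measure `κ` is the Fourier transform of `γ`: both are tempered, and
`∫ φ dκ = ∫ φ̂ dγ` for all Schwartz functions `φ`, with `φ̂ k = ∫ exp (-2π i k x) φ x dx`. -/
def IsFourierTransform {d : ℕ} (γ : RadonMeasure d) (κ : Measure (Space d)) : Prop :=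
  γ.variation.HasTemperateGrowth ∧ κ.HasTemperateGrowth ∧
    ∀ φ : 𝓢(Space d, ℂ), ∫ k, φ k ∂κ = γ.integral (𝓕 φ : 𝓢(Space d, ℂ))

/-- `κ` is the diffraction measure of `ω`: the autocorrelation of `ω` exists and its Fourier
transform is `κ`. -/
def IsDiffraction {d : ℕ} (ω : RadonMeasure d) (κ : Measure (Space d)) : Prop :=
  ∃ γ : RadonMeasure d, IsAutocorrelation ω γ ∧ IsFourierTransform γ κ

/-! ### Simple point sets and the homogeneous Poisson process -/

/-- Simple, locally finite point sets in `ℝ^d`. -/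
structure PointSet (d : ℕ) where
  /-- the set of points -/
  carrier : Set (Space d)
  finite_inter_ball : ∀ R : ℝ, (carrier ∩ Metric.ball 0 R).Finite

/-- The number of points of `Λ` in `A`. -/
noncomputable def PointSet.count {d : ℕ} (Λ : PointSet d) (A : Set (Space d)) : ℕ∞ :=
  (Λ.carrier ∩ A).encard

/-- The random point set `Λ`, defined on the probability space `(Ω, P)`, is a homogeneous Poisson
process of density `ρ`: the number of points in a measurable set `A` of finite volume is a Poisson
distributed random variable with parameter `ρ * vol A`, and the numbers of points in finitely many
pairwise disjoint measurable sets are independent. -/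
structure IsPoissonProcess {Ω : Type*} [MeasurableSpace Ω] {d : ℕ} (ρ : ℝ≥0)
    (Λ : Ω → PointSet d) (P : Measure Ω) : Prop where
  measurable_count : ∀ A : Set (Space d), MeasurableSet A → Measurable fun ξ => (Λ ξ).count A
  hasLaw_count : ∀ A : Set (Space d), MeasurableSet A → volume A ≠ ∞ →
    HasLaw (fun ξ => (Λ ξ).count A)
      ((poissonMeasure (ρ * (volume A).toNNReal)).map (Nat.cast : ℕ → ℕ∞)) P
  iIndepFun_count : ∀ (m : ℕ) (A : Fin m → Set (Space d)), (∀ i, MeasurableSet (A i)) →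
    Pairwise (fun i j => Disjoint (A i) (A j)) →
    iIndepFun (fun i ξ => (Λ ξ).count (A i)) P

/-! ### Weighted Dirac combs -/

namespace PointSet

variable {d : ℕ} (Λ : PointSet d)

open Classical in
/-- The weight function, extended by `0` off the point set. -/
noncomputable def extend (w : Λ.carrier → ℝ) (x : Space d) : ℂ :=
  if h : x ∈ Λ.carrier then (w ⟨x, h⟩ : ℂ) else 0

/-- The counting measure `∑ δ_x`, with `x` ranging over the point set. -/
noncomputable def countingMeasure : Measure (Space d) :=
  Measure.sum fun x : Λ.carrier => Measure.dirac (x : Space d)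

theorem countingMeasure_restrict_ball (R : ℝ) :
    Λ.countingMeasure.restrict (Metric.ball 0 R) =
      ∑ x ∈ (Λ.finite_inter_ball R).toFinset, Measure.dirac x := by
  classical
  ext s hs
  rw [Measure.restrict_apply hs, countingMeasure,
    Measure.sum_apply _ (hs.inter Metric.isOpen_ball.measurableSet), Measure.finsetSum_apply,
    tsum_subtype Λ.carrier fun x => Measure.dirac x (s ∩ Metric.ball 0 R),
    tsum_eq_sum (s := (Λ.finite_inter_ball R).toFinset)]
  · refine Finset.sum_congr rfl fun x hx => ?_
    have hx' : x ∈ Λ.carrier ∩ Metric.ball 0 R := by simpa using hx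
    rw [Set.indicator_of_mem hx'.1, Measure.dirac_apply' _ hs,
      Measure.dirac_apply' _ (hs.inter Metric.isOpen_ball.measurableSet)]
    by_cases h : x ∈ s <;> simp [h, Set.indicator, hx'.2] at *
  · intro x hx
    have hx' : x ∉ Λ.carrier ∩ Metric.ball 0 R := by simpa using hx
    by_cases h : x ∈ Λ.carrier
    · rw [Set.indicator_of_mem h,
        Measure.dirac_apply' _ (hs.inter Metric.isOpen_ball.measurableSet),
        Set.indicator_of_notMem]
      exact fun h2 => hx' ⟨h, h2.2⟩
    · exact Set.indicator_of_notMem h _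

instance isLocallyFiniteMeasure_countingMeasure :
    IsLocallyFiniteMeasure Λ.countingMeasure := by
  refine ⟨fun x => ⟨Metric.ball 0 (‖x‖ + 1), Metric.isOpen_ball.mem_nhds (by simp), ?_⟩⟩
  rw [← Measure.restrict_apply_univ, countingMeasure_restrict_ball]
  exact measure_lt_top _ _

theorem locallyIntegrable_countingMeasure (f : Space d → ℂ) :
    LocallyIntegrable f Λ.countingMeasure := by
  refine fun x => ⟨Metric.ball 0 (‖x‖ + 1), Metric.isOpen_ball.mem_nhds (by simp), ?_⟩
  rw [IntegrableOn, countingMeasure_restrict_ball, integrable_finsetSum_measure]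
  exact fun y _ => integrable_dirac (by simp)

/-- The weighted Dirac comb `∑ w x • δ_x`, with `x` ranging over the point set. -/
noncomputable def comb (w : Λ.carrier → ℝ) : RadonMeasure d where
  base := Λ.countingMeasure
  density := Λ.extend w
  isLocallyFinite := inferInstance
  locallyIntegrable := Λ.locallyIntegrable_countingMeasure _

end PointSet

/-- The law of a random sign: the values `1` and `-1` with equal probability. -/
noncomputable def signLaw : Measure ℝ :=
  (2⁻¹ : ℝ≥0∞) • Measure.dirac 1 + (2⁻¹ : ℝ≥0∞) • Measure.dirac (-1)

end RandomDiffraction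

open RandomDiffraction

/-! For a fixed point set, the convolution tested against `g` is the double sum of `W x * W y * g (x
- y)` over points in `B_R`. The diagonal gives the number of points times `g 0`, which after
division by the volume tends to `ρ * g 0` as soon as the point set has density `ρ`. The off-diagonal
part is a quadratic form in independent centred signs. Its terms are orthogonal, so its second
moment is at most a constant times the number of pairs of points at bounded distance. If that number
is `O(R ^ d)`, the form is typically of order `R ^ (d / 2)`, which is negligible against the volume.

To get almost sure convergence along all real `R`, the points are enumerated by increasing norm.
Every ball is then an initial segment, the off-diagonal sum becomes a martingale, and Doob's
inequality controls all `R ≤ T` at once (`measure_exists_correlation_sq_ge_le`). Borel-Cantelli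
along `T = 2 ^ n` finishes the case of one test function. A countable uniformly dense family and the
pair bound extend it to all test functions on one event (`ae_forall_tendsto_correlation`).

The point set enters only through `PointSet.IsRegular`: density `ρ` and the pair bound. Poisson
processes satisfy both almost surely (`IsPoissonProcess.ae_isRegular`), by Chebyshev bounds for ball
counts and for sums of squared counts in unit cubes. Finally, the Fourier transform of `δ_0` is
Lebesgue measure because `φ̂ 0` is the integral of `φ`. -/

namespace RandomDiffraction

/-! ### Quadratic chaos of bounded centred noise -/

section Chaos

variable {Ω : Type*} {m0 : MeasurableSpace Ω} {μ : Measure Ω}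

/-- `v` is a sequence of random variables in `[-1, 1]` with mean zero, such that `v j` is known at
time `j + 1` and independent of the information at time `j`. -/
structure IsBoundedNoise (ℱ : Filtration ℕ m0) (v : ℕ → Ω → ℝ) (μ : Measure Ω) : Prop where
  adapted : ∀ j, Measurable[ℱ (j + 1)] (v j)
  abs_le_one : ∀ j ω, |v j ω| ≤ 1
  mean_zero : ∀ j, ∫ ω, v j ω ∂μ = 0
  indep : ∀ j, Indep (MeasurableSpace.comap (v j) inferInstance) (ℱ j) μ

/-- A bounded function that is measurable with respect to `m`. -/
def IsBoundedMeasurable (m : MeasurableSpace Ω) (X : Ω → ℝ) : Prop :=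
  Measurable[m] X ∧ ∃ C, ∀ ω, |X ω| ≤ C

namespace IsBoundedMeasurable

variable {m m' : MeasurableSpace Ω} {X Y : Ω → ℝ}

theorem zero : IsBoundedMeasurable m fun _ : Ω => (0 : ℝ) :=
  ⟨measurable_const, 0, fun _ => by simp⟩

theorem mono (h : IsBoundedMeasurable m X) (hm : m ≤ m') : IsBoundedMeasurable m' X :=
  ⟨h.1.mono hm le_rfl, h.2⟩

theorem add (hX : IsBoundedMeasurable m X) (hY : IsBoundedMeasurable m Y) :
    IsBoundedMeasurable m fun ω => X ω + Y ω := by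
  obtain ⟨hX, C, hC⟩ := hX
  obtain ⟨hY, D, hD⟩ := hY
  exact ⟨hX.add hY, C + D, fun ω => (abs_add_le _ _).trans (add_le_add (hC ω) (hD ω))⟩

theorem mul (hX : IsBoundedMeasurable m X) (hY : IsBoundedMeasurable m Y) :
    IsBoundedMeasurable m fun ω => X ω * Y ω := by
  obtain ⟨hX, C, hC⟩ := hX
  obtain ⟨hY, D, hD⟩ := hY
  refine ⟨hX.mul hY, C * D, fun ω => ?_⟩
  rw [abs_mul]
  exact mul_le_mul (hC ω) (hD ω) (abs_nonneg _) ((abs_nonneg _).trans (hC ω))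

theorem const_mul (c : ℝ) (hX : IsBoundedMeasurable m X) :
    IsBoundedMeasurable m fun ω => c * X ω :=
  mul ⟨measurable_const, |c|, fun _ => le_rfl⟩ hX

theorem sq (hX : IsBoundedMeasurable m X) : IsBoundedMeasurable m fun ω => X ω ^ 2 := by
  simpa only [_root_.sq] using hX.mul hX

theorem indicator (hX : IsBoundedMeasurable m X) {s : Set Ω} (hs : MeasurableSet[m] s) :
    IsBoundedMeasurable m (s.indicator X) := by
  obtain ⟨hX, C, hC⟩ := hX
  refine ⟨hX.indicator hs, C, fun ω => ?_⟩
  by_cases h : ω ∈ s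
  · simpa [h] using hC ω
  · simpa [h] using (abs_nonneg _).trans (hC ω)

theorem integrable [IsFiniteMeasure μ] (hX : IsBoundedMeasurable m X) (hm : m ≤ m0) :
    Integrable X μ := by
  obtain ⟨hX, C, hC⟩ := hX
  exact Integrable.of_bound (hX.mono hm le_rfl).aestronglyMeasurable C (ae_of_all _ hC)

end IsBoundedMeasurable

namespace IsBoundedNoise

variable {ℱ : Filtration ℕ m0} {v : ℕ → Ω → ℝ}

theorem isBoundedMeasurable (h : IsBoundedNoise ℱ v μ) (j : ℕ) :
    IsBoundedMeasurable (ℱ (j + 1)) (v j) :=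
  ⟨h.adapted j, 1, h.abs_le_one j⟩

theorem integral_mul_eq_zero (h : IsBoundedNoise ℱ v μ) {j : ℕ} {Y : Ω → ℝ}
    (hY : IsBoundedMeasurable (ℱ j) Y) :
    ∫ ω, v j ω * Y ω ∂μ = 0 := by
  have hind : IndepFun (v j) Y μ := by
    rw [IndepFun_iff_Indep]
    exact indep_of_indep_of_le_right (h.indep j) hY.1.comap_le
  rw [hind.integral_fun_mul_eq_mul_integral
    ((h.adapted j).mono (ℱ.le _) le_rfl).aestronglyMeasurable
    (hY.1.mono (ℱ.le _) le_rfl).aestronglyMeasurable, h.mean_zero, zero_mul]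

variable [IsProbabilityMeasure μ]

/-- The cross term vanishes on every event of the past, since the indicator of `s` times `X * L` is
still independent of the centred `v j`. The localisation to `s` is what yields the submartingale
property below. -/
theorem setIntegral_add_mul_sq (h : IsBoundedNoise ℱ v μ) {j : ℕ} {X L : Ω → ℝ}
    (hX : IsBoundedMeasurable (ℱ j) X)
    (hL : IsBoundedMeasurable (ℱ j) L) {s : Set Ω} (hs : MeasurableSet[ℱ j] s) :
    ∫ ω in s, (X ω + v j ω * L ω) ^ 2 ∂μ =
      ∫ ω in s, X ω ^ 2 ∂μ + ∫ ω in s, (v j ω * L ω) ^ 2 ∂μ := by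
  have hvL : IsBoundedMeasurable (ℱ (j + 1)) fun ω => v j ω * L ω :=
    (h.isBoundedMeasurable j).mul (hL.mono (ℱ.mono j.le_succ))
  have hcross : ∫ ω in s, v j ω * (X ω * L ω) ∂μ = 0 := by
    rw [← integral_indicator (ℱ.le _ _ hs),
      ← h.integral_mul_eq_zero ((hX.mul hL).indicator hs)]
    refine integral_congr_ae (ae_of_all _ fun ω => ?_)
    by_cases hω : ω ∈ s <;> simp [hω]
  have h1 : Integrable (fun ω => X ω ^ 2) μ := hX.sq.integrable (ℱ.le _)
  have h2 : Integrable (fun ω => (v j ω * L ω) ^ 2) μ := hvL.sq.integrable (ℱ.le _)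
  have h3 : Integrable (fun ω => v j ω * (X ω * L ω)) μ :=
    ((h.isBoundedMeasurable j).mul ((hX.mul hL).mono (ℱ.mono j.le_succ))).integrable (ℱ.le _)
  calc ∫ ω in s, (X ω + v j ω * L ω) ^ 2 ∂μ
      = ∫ ω in s, (X ω ^ 2 + (v j ω * L ω) ^ 2 + 2 * (v j ω * (X ω * L ω))) ∂μ := by
        congr 1 with ω; ring
    _ = _ := by
        have h12 : Integrable (fun ω => X ω ^ 2 + (v j ω * L ω) ^ 2) μ := h1.add h2
        rw [integral_add h12.integrableOn (h3.const_mul 2).integrableOn,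
          integral_add h1.integrableOn h2.integrableOn, integral_const_mul, hcross]
        ring

theorem integral_add_mul_sq_le (h : IsBoundedNoise ℱ v μ) {j : ℕ} {X L : Ω → ℝ}
    (hX : IsBoundedMeasurable (ℱ j) X)
    (hL : IsBoundedMeasurable (ℱ j) L) :
    ∫ ω, (X ω + v j ω * L ω) ^ 2 ∂μ ≤ ∫ ω, X ω ^ 2 ∂μ + ∫ ω, L ω ^ 2 ∂μ := by
  have := h.setIntegral_add_mul_sq hX hL (MeasurableSet.univ)
  simp only [Measure.restrict_univ] at this
  rw [this]
  gcongr
  · exact ((h.isBoundedMeasurable j).mul (hL.mono (ℱ.mono j.le_succ))).sq.integrable (ℱ.le _)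
  · exact hL.sq.integrable (ℱ.le _)
  · intro ω
    have h1 : (v j ω) ^ 2 ≤ 1 := (sq_le_one_iff_abs_le_one _).2 (h.abs_le_one j ω)
    simp only [mul_pow]
    exact mul_le_of_le_one_left (sq_nonneg _) h1

end IsBoundedNoise

/-- The linear form `∑ c a * v a`, with `a < j`. -/
def linearChaos (v : ℕ → Ω → ℝ) (c : ℕ → ℝ) (j : ℕ) (ω : Ω) : ℝ :=
  ∑ a ∈ Finset.range j, v a ω * c a

/-- The quadratic form `∑ c a b * v a * v b`, with `a < b < j`. -/
def quadraticChaos (v : ℕ → Ω → ℝ) (c : ℕ → ℕ → ℝ) (j : ℕ) (ω : Ω) : ℝ :=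
  ∑ b ∈ Finset.range j, v b ω * linearChaos v (fun a => c a b) b ω

namespace IsBoundedNoise

variable {ℱ : Filtration ℕ m0} {v : ℕ → Ω → ℝ}

theorem isBoundedMeasurable_linearChaos (h : IsBoundedNoise ℱ v μ) (c : ℕ → ℝ) (j : ℕ) :
    IsBoundedMeasurable (ℱ j) (linearChaos v c j) := by
  induction j with
  | zero => exact IsBoundedMeasurable.zero
  | succ j ih =>
    have h1 : linearChaos v c (j + 1) = fun ω => linearChaos v c j ω + c j * v j ω := by
      ext ω; simp [linearChaos, Finset.sum_range_succ, mul_comm]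
    rw [h1]
    exact (ih.mono (ℱ.mono j.le_succ)).add ((h.isBoundedMeasurable j).const_mul _)

theorem isBoundedMeasurable_quadraticChaos (h : IsBoundedNoise ℱ v μ) (c : ℕ → ℕ → ℝ) (j : ℕ) :
    IsBoundedMeasurable (ℱ j) (quadraticChaos v c j) := by
  induction j with
  | zero => exact IsBoundedMeasurable.zero
  | succ j ih =>
    have h1 : quadraticChaos v c (j + 1) =
        fun ω => quadraticChaos v c j ω + v j ω * linearChaos v (fun a => c a j) j ω := by
      ext ω; simp [quadraticChaos, Finset.sum_range_succ]
    rw [h1]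
    exact (ih.mono (ℱ.mono j.le_succ)).add ((h.isBoundedMeasurable j).mul
      ((h.isBoundedMeasurable_linearChaos _ j).mono (ℱ.mono j.le_succ)))

variable [IsProbabilityMeasure μ]

theorem integral_linearChaos_sq_le (h : IsBoundedNoise ℱ v μ) (c : ℕ → ℝ) (j : ℕ) :
    ∫ ω, linearChaos v c j ω ^ 2 ∂μ ≤ ∑ a ∈ Finset.range j, c a ^ 2 := by
  induction j with
  | zero => simp [linearChaos]
  | succ j ih =>
    have h1 : linearChaos v c (j + 1) = fun ω => linearChaos v c j ω + v j ω * c j := by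
      ext ω; simp [linearChaos, Finset.sum_range_succ]
    have h2 := h.integral_add_mul_sq_le (h.isBoundedMeasurable_linearChaos c j)
      (L := fun _ => c j) ⟨measurable_const, |c j|, fun _ => le_rfl⟩
    rw [h1, Finset.sum_range_succ]
    simp only [integral_const, probReal_univ, one_smul] at h2
    linarith

theorem integral_quadraticChaos_sq_le (h : IsBoundedNoise ℱ v μ) (c : ℕ → ℕ → ℝ) (j : ℕ) :
    ∫ ω, quadraticChaos v c j ω ^ 2 ∂μ ≤
      ∑ b ∈ Finset.range j, ∑ a ∈ Finset.range b, c a b ^ 2 := by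
  induction j with
  | zero => simp [quadraticChaos]
  | succ j ih =>
    have h1 : quadraticChaos v c (j + 1) =
        fun ω => quadraticChaos v c j ω + v j ω * linearChaos v (fun a => c a j) j ω := by
      ext ω; simp [quadraticChaos, Finset.sum_range_succ]
    have h2 := h.integral_add_mul_sq_le (h.isBoundedMeasurable_quadraticChaos c j)
      (h.isBoundedMeasurable_linearChaos (fun a => c a j) j)
    have h3 := h.integral_linearChaos_sq_le (fun a => c a j) j
    rw [h1, Finset.sum_range_succ]
    linarith

theorem submartingale_quadraticChaos_sq (h : IsBoundedNoise ℱ v μ) (c : ℕ → ℕ → ℝ) :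
    Submartingale (fun j ω => quadraticChaos v c j ω ^ 2) ℱ μ := by
  refine submartingale_of_setIntegral_le_succ
    (fun j => (h.isBoundedMeasurable_quadraticChaos c j).sq.1.stronglyMeasurable)
    (fun j => (h.isBoundedMeasurable_quadraticChaos c j).sq.integrable (ℱ.le _)) fun j s hs => ?_
  have h1 : quadraticChaos v c (j + 1) =
      fun ω => quadraticChaos v c j ω + v j ω * linearChaos v (fun a => c a j) j ω := by
    ext ω; simp [quadraticChaos, Finset.sum_range_succ]
  rw [h1, h.setIntegral_add_mul_sq (h.isBoundedMeasurable_quadraticChaos c j)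
    (h.isBoundedMeasurable_linearChaos _ j) hs]
  exact le_add_of_nonneg_right (integral_nonneg fun ω => sq_nonneg _)

/-- Doob's maximal inequality for the squared chaos: all times `j ≤ N` are controlled at the price
of the second moment at time `N` alone. -/
theorem measure_exists_quadraticChaos_sq_ge_le (h : IsBoundedNoise ℱ v μ)
    (c : ℕ → ℕ → ℝ) (N : ℕ) {t : ℝ} (ht : 0 < t) :
    μ {ω | ∃ j ≤ N, t ≤ quadraticChaos v c j ω ^ 2} ≤
      ENNReal.ofReal ((∑ b ∈ Finset.range N, ∑ a ∈ Finset.range b, c a b ^ 2) / t) := by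
  have h1 := maximal_ineq (h.submartingale_quadraticChaos_sq c)
    (fun j ω => sq_nonneg _) (ε := t.toNNReal) N
  have h2 : ∀ ω, (((t.toNNReal : ℝ≥0) : ℝ) ≤ (Finset.range (N + 1)).sup'
      Finset.nonempty_range_add_one fun k => quadraticChaos v c k ω ^ 2) ↔
      ∃ j ≤ N, t ≤ quadraticChaos v c j ω ^ 2 := by
    intro ω
    rw [Real.coe_toNNReal _ ht.le, Finset.le_sup'_iff]
    simp
  simp only [h2] at h1
  rw [ENNReal.ofReal_div_of_pos ht, ENNReal.le_div_iff_mul_le (by simp [ht]) (by simp), mul_comm]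
  refine h1.trans (ENNReal.ofReal_le_ofReal ?_)
  refine le_trans ?_ (h.integral_quadraticChaos_sq_le c N)
  exact setIntegral_le_integral
    ((h.isBoundedMeasurable_quadraticChaos c N).sq.integrable (ℱ.le _))
    (ae_of_all _ fun ω => sq_nonneg _)

end IsBoundedNoise

end Chaos

/-! ### Finite correlation sums -/

section Correlation

variable {d : ℕ}

/-- The sum of `u x * u y * g (x - y)` over all pairs of points of a finite set. -/
noncomputable def correlation {E : Type*} [AddCommGroup E] [Module ℝ E] (s : Finset (Space d))
    (u : Space d → ℝ) (g : Space d → E) : E :=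
  ∑ x ∈ s, ∑ y ∈ s, (u x * u y) • g (x - y)

/-- The number of pairs of points of a finite set that have distance at most `r`. -/
noncomputable def nearPairs (s : Finset (Space d)) (r : ℕ) : ℕ :=
  ((s ×ˢ s).filter fun z => ‖z.1 - z.2‖ ≤ r).card

theorem nearPairs_mono {s t : Finset (Space d)} (h : s ⊆ t) (r : ℕ) :
    nearPairs s r ≤ nearPairs t r :=
  Finset.card_le_card (Finset.filter_subset_filter _ (Finset.product_subset_product h h))

theorem sum_sum_norm_le {E : Type*} [SeminormedAddCommGroup E] (s : Finset (Space d)) {r : ℕ}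
    {g : Space d → E} {M : ℝ} (hM : ∀ z, ‖g z‖ ≤ M) (hg : ∀ z, r < ‖z‖ → g z = 0) :
    ∑ x ∈ s, ∑ y ∈ s, ‖g (x - y)‖ ≤ M * nearPairs s r := by
  rw [← Finset.sum_product', nearPairs,
    ← Finset.sum_filter_of_ne (p := fun z => ‖z.1 - z.2‖ ≤ r)]
  · refine (Finset.sum_le_card_nsmul _ _ M fun z _ => hM _).trans ?_
    rw [nsmul_eq_mul, mul_comm]
  · intro z _ hz
    by_contra h
    exact hz (by simp [hg _ (not_le.1 h)])

theorem correlation_sub {E : Type*} [AddCommGroup E] [Module ℝ E] (s : Finset (Space d))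
    (u : Space d → ℝ) (g h : Space d → E) :
    correlation s u g - correlation s u h = correlation s u fun z => g z - h z := by
  simp [correlation, smul_sub, Finset.sum_sub_distrib]

theorem norm_correlation_le {E : Type*} [SeminormedAddCommGroup E] [NormedSpace ℝ E]
    (s : Finset (Space d)) {u : Space d → ℝ} (hu : ∀ x ∈ s, |u x| ≤ 1) {r : ℕ}
    {g : Space d → E} {M : ℝ} (hM : ∀ z, ‖g z‖ ≤ M) (hg : ∀ z, r < ‖z‖ → g z = 0) :
    ‖correlation s u g‖ ≤ M * nearPairs s r := by
  refine le_trans ?_ (sum_sum_norm_le s hM hg)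
  refine (norm_sum_le _ _).trans (Finset.sum_le_sum fun x hx => ?_)
  refine (norm_sum_le _ _).trans (Finset.sum_le_sum fun y hy => ?_)
  rw [norm_smul, norm_mul]
  exact mul_le_of_le_one_left (norm_nonneg _)
    (mul_le_one₀ (hu x hx) (norm_nonneg _) (hu y hy))

theorem correlation_re (s : Finset (Space d)) (u : Space d → ℝ) (g : Space d → ℂ) :
    (correlation s u g).re = correlation s u fun z => (g z).re := by
  simp [correlation]

theorem correlation_im (s : Finset (Space d)) (u : Space d → ℝ) (g : Space d → ℂ) :
    (correlation s u g).im = correlation s u fun z => (g z).im := by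
  simp [correlation]

theorem sum_range_sum_range_eq (F : ℕ → ℕ → ℝ) (j : ℕ) :
    ∑ a ∈ Finset.range j, ∑ b ∈ Finset.range j, F a b =
      ∑ b ∈ Finset.range j, ∑ a ∈ Finset.range b, (F a b + F b a) +
        ∑ a ∈ Finset.range j, F a a := by
  induction j with
  | zero => simp
  | succ j ih =>
    simp only [Finset.sum_range_succ, Finset.sum_add_distrib] at ih ⊢
    linarith

/-- Each diagonal pair contributes `f 0` because the weights square to one; each unordered pair `a <
b` collects both orders. One enumeration serves every prefix `j ≤ N`, so `j` can act as martingale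
time. -/
theorem correlation_image_range {N j : ℕ} (hj : j ≤ N) {p : ℕ → Space d}
    (hp : Set.InjOn p (Set.Iio N)) {u : Space d → ℝ} (hu : ∀ i < N, u (p i) ^ 2 = 1)
    (f : Space d → ℝ) {Ω : Type*} {v : ℕ → Ω → ℝ} {ω : Ω} (hv : ∀ i < N, v i ω = u (p i)) :
    correlation ((Finset.range j).image p) u f =
      quadraticChaos v (fun a b => f (p a - p b) + f (p b - p a)) j ω + j * f 0 := by
  have hinj : Set.InjOn p (Finset.range j : Finset ℕ) := hp.mono fun i hi => by
    simp only [Finset.coe_range, Set.mem_Iio] at hi ⊢; lia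
  rw [correlation, Finset.sum_image hinj]
  simp_rw [Finset.sum_image hinj]
  rw [sum_range_sum_range_eq fun a b => (u (p a) * u (p b)) • f (p a - p b)]
  congr 1
  · refine Finset.sum_congr rfl fun b hb => ?_
    rw [linearChaos, Finset.mul_sum]
    refine Finset.sum_congr rfl fun a ha => ?_
    simp only [Finset.mem_range] at ha hb
    rw [hv a (by lia), hv b (by lia), smul_eq_mul, smul_eq_mul]
    ring
  · rw [Finset.sum_congr rfl (g := fun _ => f 0), Finset.sum_const, Finset.card_range,
      nsmul_eq_mul]
    intro a ha
    simp only [Finset.mem_range] at ha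
    rw [sub_self, smul_eq_mul, ← sq, hu a (by lia), one_mul]

theorem sum_sq_symmetrized_le {N : ℕ} {p : ℕ → Space d} (hp : Set.InjOn p (Set.Iio N))
    {r : ℕ} {f : Space d → ℝ} {M : ℝ} (hM : ∀ z, |f z| ≤ M) (hf : ∀ z, r < ‖z‖ → f z = 0) :
    ∑ b ∈ Finset.range N, ∑ a ∈ Finset.range b, (f (p a - p b) + f (p b - p a)) ^ 2 ≤
      2 * M ^ 2 * nearPairs ((Finset.range N).image p) r := by
  have hinj : Set.InjOn p (Finset.range N : Finset ℕ) := by simpa using hp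
  have h1 := sum_sum_norm_le ((Finset.range N).image p) (g := fun z => f z ^ 2) (M := M ^ 2)
    (r := r) (fun z => by
      rw [Real.norm_eq_abs, abs_pow]
      exact pow_le_pow_left₀ (abs_nonneg _) (hM z) 2) (fun z hz => by simp [hf z hz])
  rw [Finset.sum_image hinj] at h1
  simp_rw [Finset.sum_image hinj] at h1
  rw [sum_range_sum_range_eq fun a b => ‖f (p a - p b) ^ 2‖] at h1
  have h2 : 0 ≤ ∑ a ∈ Finset.range N, ‖f (p a - p a) ^ 2‖ :=
    Finset.sum_nonneg fun _ _ => norm_nonneg _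
  have h3 : ∑ b ∈ Finset.range N, ∑ a ∈ Finset.range b, (f (p a - p b) + f (p b - p a)) ^ 2 ≤
      2 * ∑ b ∈ Finset.range N, ∑ a ∈ Finset.range b,
        (‖f (p a - p b) ^ 2‖ + ‖f (p b - p a) ^ 2‖) := by
    simp_rw [Finset.mul_sum]
    refine Finset.sum_le_sum fun b _ => Finset.sum_le_sum fun a _ => ?_
    rw [Real.norm_of_nonneg (sq_nonneg _), Real.norm_of_nonneg (sq_nonneg _)]
    nlinarith [sq_nonneg (f (p a - p b) - f (p b - p a))]
  linarith

/-- Sorting by norm turns the radius into a time index: the open balls cut out initial segments,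
even when several points share a norm. -/
theorem exists_enumeration_norm_monotone (s : Finset (Space d)) :
    ∃ p : ℕ → Space d, Set.InjOn p (Set.Iio s.card) ∧ (Finset.range s.card).image p = s ∧
      ∀ R : ℝ, ∃ j ≤ s.card, (Finset.range j).image p = s.filter (‖·‖ < R) := by
  classical
  let e₀ : Fin s.card ≃ s := s.equivFin.symm
  let φ : Fin s.card → ℝ := fun i => ‖(e₀ i : Space d)‖
  let e : Fin s.card ≃ s := (Tuple.sort φ).trans e₀
  have hmono : Monotone fun i => ‖(e i : Space d)‖ := Tuple.monotone_sort φ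
  -- The default value `0` is harmless: the conclusions concern only indices below `s.card`.
  let p : ℕ → Space d := fun i => if h : i < s.card then e ⟨i, h⟩ else 0
  have hpe : ∀ i (h : i < s.card), p i = e ⟨i, h⟩ := fun i h => by simp [p, h]
  have hmem : ∀ x, x ∈ s ↔ ∃ i < s.card, p i = x := by
    intro x
    constructor
    · intro hx
      refine ⟨e.symm ⟨x, hx⟩, (e.symm ⟨x, hx⟩).2, ?_⟩
      rw [hpe _ (e.symm ⟨x, hx⟩).2]
      simp
    · rintro ⟨i, hi, rfl⟩
      rw [hpe i hi]
      exact (e ⟨i, hi⟩).2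
  refine ⟨p, fun i hi j hj hij => ?_, ?_, fun R => ?_⟩
  · rw [hpe i hi, hpe j hj] at hij
    exact congrArg Fin.val (e.injective (Subtype.ext hij))
  · ext x
    simp [hmem]
  · have hex : ∃ j, s.card ≤ j ∨ R ≤ ‖p j‖ := ⟨s.card, Or.inl le_rfl⟩
    refine ⟨Nat.find hex, Nat.find_min' hex (Or.inl le_rfl), ?_⟩
    ext x
    simp only [Finset.mem_image, Finset.mem_range, Finset.mem_filter, hmem]
    constructor
    · rintro ⟨i, hi, rfl⟩
      have := Nat.find_min hex hi
      push Not at this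
      exact ⟨⟨i, this.1, rfl⟩, this.2⟩
    · rintro ⟨⟨i, hi, rfl⟩, hR⟩
      refine ⟨i, ?_, rfl⟩
      by_contra hlt
      rcases Nat.find_spec hex with h | h
      · lia
      · refine absurd hR (not_lt.2 (h.trans ?_))
        rw [hpe i hi, hpe _ (lt_of_le_of_lt (not_lt.1 hlt) hi)]
        exact hmono (Fin.mk_le_mk.2 (not_lt.1 hlt))

end Correlation

/-! ### Point sets in balls -/

namespace PointSet

variable {d : ℕ} (Λ : PointSet d)

/-- The points of `Λ` in the open ball of radius `R`. -/
noncomputable def ballPoints (R : ℝ) : Finset (Space d) :=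
  (Λ.finite_inter_ball R).toFinset

theorem mem_ballPoints {R : ℝ} {x : Space d} :
    x ∈ Λ.ballPoints R ↔ x ∈ Λ.carrier ∧ ‖x‖ < R := by
  simp [ballPoints]

theorem ballPoints_mono {R T : ℝ} (h : R ≤ T) : Λ.ballPoints R ⊆ Λ.ballPoints T := by
  intro x
  simp only [mem_ballPoints]
  exact fun hx => ⟨hx.1, hx.2.trans_le h⟩

theorem filter_ballPoints {R T : ℝ} (h : R ≤ T) :
    (Λ.ballPoints T).filter (‖·‖ < R) = Λ.ballPoints R := by
  ext x
  simp only [Finset.mem_filter, mem_ballPoints]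
  exact ⟨fun hx => ⟨hx.1.1, hx.2⟩, fun hx => ⟨⟨hx.1, hx.2.trans_le h⟩, hx.2⟩⟩

theorem countable_carrier : Λ.carrier.Countable := by
  have : Λ.carrier = ⋃ n : ℕ, Λ.carrier ∩ Metric.ball 0 n := by
    rw [← Set.inter_iUnion, Metric.iUnion_ball_nat, Set.inter_univ]
  rw [this]
  exact Set.countable_iUnion fun n => (Λ.finite_inter_ball n).countable

theorem integral_comb_restrict_ball (w : Λ.carrier → ℝ) (R : ℝ) (g : Space d → ℂ) :
    ((Λ.comb w).restrict (Metric.ball 0 R)).integral g =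
      ∑ x ∈ Λ.ballPoints R, g x * Λ.extend w x := by
  simp only [RadonMeasure.integral, RadonMeasure.restrict, comb]
  rw [countingMeasure_restrict_ball, integral_finsetSum_measure]
  · exact Finset.sum_congr rfl fun x _ => integral_dirac _ _
  · exact fun x _ => integrable_dirac enorm_lt_top

/-- The flip turns `x + y` into `x - y`, and real weights are fixed by the conjugations. Only the
values of `u` on the point set matter, which leaves its extension free. -/
theorem functionalConv_comb_restrict_ball (w : Λ.carrier → ℝ) (R : ℝ) {u : Space d → ℝ}
    (hu : ∀ x : Λ.carrier, u x = w x) (g : Space d → ℂ) :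
    functionalConv ((Λ.comb w).restrict (Metric.ball 0 R)).integral
        (functionalFlip ((Λ.comb w).restrict (Metric.ball 0 R)).integral) g =
      correlation (Λ.ballPoints R) u g := by
  have hext : ∀ x ∈ Λ.ballPoints R, Λ.extend w x = u x := by
    intro x hx
    have hx' := (Λ.mem_ballPoints.1 hx).1
    rw [extend, dif_pos hx', ← hu]
  simp only [functionalConv, functionalFlip, integral_comb_restrict_ball, correlation]
  refine Finset.sum_congr rfl fun x hx => ?_
  rw [hext x hx, map_sum, Finset.sum_mul]
  refine Finset.sum_congr rfl fun y hy => ?_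
  rw [hext y hy]
  simp only [map_mul, Complex.conj_conj, Complex.conj_ofReal, Complex.real_smul,
    Complex.ofReal_mul, sub_eq_add_neg]
  ring

end PointSet

/-! ### Volumes of balls -/

section Volume

variable {d : ℕ}

theorem volume_unitBall_toReal_pos : 0 < (volume (Metric.ball (0 : Space d) 1)).toReal :=
  ENNReal.toReal_pos (Metric.measure_ball_pos _ _ one_pos).ne' measure_ball_lt_top.ne

theorem volume_ball_toReal {R : ℝ} (hR : 0 < R) :
    (volume (Metric.ball (0 : Space d) R)).toReal =
      R ^ d * (volume (Metric.ball (0 : Space d) 1)).toReal := by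
  rw [Measure.addHaar_ball_of_pos _ _ hR, ENNReal.toReal_mul,
    ENNReal.toReal_ofReal (by positivity), finrank_euclideanSpace_fin]

/-- The squared quotient is of order `R ^ (1 / 2 - d)`, hence at most of order `1 / √R` when `d ≥
1`. -/
theorem tendsto_div_volume_ball_of_sq_le (hd : 1 ≤ d) {q : ℝ → ℝ} {A : ℝ}
    (h : ∀ᶠ R in atTop, q R ^ 2 ≤ A * (R ^ d * √R)) :
    Tendsto (fun R => q R / (volume (Metric.ball (0 : Space d) R)).toReal) atTop (𝓝 0) := by
  set v := (volume (Metric.ball (0 : Space d) 1)).toReal with hv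
  have hv0 : 0 < v := volume_unitBall_toReal_pos
  have h1 : Tendsto (fun R : ℝ => |A| / v ^ 2 / √R) atTop (𝓝 0) :=
    tendsto_const_nhds.div_atTop Real.tendsto_sqrt_atTop
  have h2 : Tendsto (fun R => (q R / (volume (Metric.ball (0 : Space d) R)).toReal) ^ 2)
      atTop (𝓝 0) := by
    refine tendsto_of_tendsto_of_tendsto_of_le_of_le' tendsto_const_nhds h1
      (Eventually.of_forall fun R => sq_nonneg _) ?_
    filter_upwards [h, eventually_ge_atTop 1] with R hR hR1
    have hR0 : 0 < R := by linarith
    have hs : 0 < √R := Real.sqrt_pos.2 hR0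
    have hRd : R ≤ R ^ d := le_self_pow₀ hR1 (by lia)
    rw [volume_ball_toReal hR0, ← hv, div_pow, div_div, div_le_div_iff₀ (by positivity)
      (by positivity)]
    have h3 : q R ^ 2 ≤ |A| * (R ^ d * √R) :=
      hR.trans (mul_le_mul_of_nonneg_right (le_abs_self A) (by positivity))
    calc q R ^ 2 * (v ^ 2 * √R) ≤ |A| * (R ^ d * √R) * (v ^ 2 * √R) := by gcongr
      _ = |A| * v ^ 2 * R ^ d * (√R * √R) := by ring
      _ = |A| * v ^ 2 * R ^ d * R := by rw [Real.mul_self_sqrt hR0.le]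
      _ ≤ |A| * v ^ 2 * R ^ d * R ^ d := by gcongr
      _ = |A| * (R ^ d * v) ^ 2 := by ring
  have h4 := h2.sqrt
  simp only [Real.sqrt_sq_eq_abs, Real.sqrt_zero] at h4
  exact (tendsto_zero_iff_abs_tendsto_zero _).2 h4

end Volume

/-! ### Families of independent signs -/

/-- A family of independent, symmetric random signs. -/
structure IsSignFamily {ι Ω : Type*} [MeasurableSpace Ω] (V : ι → Ω → ℝ) (μ : Measure Ω) :
    Prop where
  measurable : ∀ x, Measurable (V x)
  sq_eq_one : ∀ x ω, V x ω ^ 2 = 1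
  mean_zero : ∀ x, ∫ ω, V x ω ∂μ = 0
  iIndepFun : iIndepFun V μ

/-- The law fixes the values `1` and `-1` only almost surely and gives only a.e. measurability.
Rounding a measurable version by `φ` makes both properties hold everywhere. -/
theorem exists_isSignFamily {ι Ω : Type*} [MeasurableSpace Ω] {μ : Measure Ω} {W : ι → Ω → ℝ}
    (hW : ∀ x, HasLaw (W x) signLaw μ) (hi : iIndepFun W μ) :
    ∃ V : ι → Ω → ℝ, IsSignFamily V μ ∧ ∀ x, W x =ᵐ[μ] V x := by
  classical
  let φ : ℝ → ℝ := fun t => if t = 1 then 1 else -1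
  have hφ : Measurable φ :=
    Measurable.ite (measurableSet_singleton _) measurable_const measurable_const
  have hne : (-1 : ℝ) ≠ 1 := by norm_num
  let V₀ : ι → Ω → ℝ := fun x => (hW x).aemeasurable.mk (W x)
  have hV₀ : ∀ x, W x =ᵐ[μ] V₀ x := fun x => (hW x).aemeasurable.ae_eq_mk
  have hVW : ∀ x, W x =ᵐ[μ] φ ∘ V₀ x := by
    intro x
    have h1 : ∀ᵐ ω ∂μ, φ (W x ω) = W x ω := by
      rw [(hW x).ae_iff (p := fun t => φ t = t)
        (measurableSet_setOfPred.1 (measurableSet_eq_fun hφ measurable_id))]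
      rw [signLaw, ae_add_measure_iff]
      refine ⟨Measure.ae_smul_measure ?_ _, Measure.ae_smul_measure ?_ _⟩
      · rw [ae_dirac_eq]
        simp [φ]
      · rw [ae_dirac_eq]
        simp [φ, hne]
    filter_upwards [h1, hV₀ x] with ω h h'
    simp only [Function.comp_apply, ← h', h]
  refine ⟨fun x => φ ∘ V₀ x, ⟨fun x => hφ.comp (hW x).aemeasurable.measurable_mk, ?_, ?_, ?_⟩,
    hVW⟩
  · intro x ω
    by_cases h : V₀ x ω = 1 <;> simp [φ, h]
  · intro x
    rw [← integral_congr_ae (hVW x), (hW x).integral_eq, signLaw, integral_add_measure,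
      integral_smul_measure, integral_smul_measure, integral_dirac, integral_dirac]
    · simp
    · exact (integrable_dirac enorm_lt_top).smul_measure (by simp)
    · exact (integrable_dirac enorm_lt_top).smul_measure (by simp)
  · exact iIndepFun.congr (fun x => hVW x) hi

/-- The filtration at time `j` is generated by the signs with index strictly below `j`; injectivity
of `e` keeps the sign of index `j` out of it. Padding by zero beyond `N` preserves all the noise
axioms. -/
theorem IsSignFamily.exists_isBoundedNoise {ι Ω : Type*} [MeasurableSpace Ω] {μ : Measure Ω}
    [IsProbabilityMeasure μ] {V : ι → Ω → ℝ} (hV : IsSignFamily V μ) {N : ℕ} {e : Fin N → ι}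
    (he : Function.Injective e) :
    ∃ ℱ : Filtration ℕ (inferInstance : MeasurableSpace Ω),
      IsBoundedNoise ℱ (fun i => if h : i < N then V (e ⟨i, h⟩) else 0) μ := by
  have hle : ∀ x, MeasurableSpace.comap (V x) inferInstance ≤ (inferInstance : MeasurableSpace Ω) :=
    fun x => (hV.measurable x).comap_le
  let S : ℕ → Set ι := fun j => {x | ∃ i : Fin N, (i : ℕ) < j ∧ e i = x}
  let ℱ : Filtration ℕ (inferInstance : MeasurableSpace Ω) :=
    { seq := fun j => ⨆ x ∈ S j, MeasurableSpace.comap (V x) inferInstance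
      mono' := by
        intro j k hjk
        refine biSup_mono fun x hx => ?_
        obtain ⟨i, hi, hx⟩ := hx
        exact ⟨i, hi.trans_le hjk, hx⟩
      le' := fun j => iSup₂_le fun x _ => hle x }
  refine ⟨ℱ, ⟨fun j => ?_, fun j ω => ?_, fun j => ?_, fun j => ?_⟩⟩
  · split_ifs with h
    · refine Measurable.mono (comap_measurable (V (e ⟨j, h⟩))) ?_ le_rfl
      exact le_iSup₂_of_le (e ⟨j, h⟩) ⟨⟨j, h⟩, Nat.lt_succ_self j, rfl⟩ le_rfl
    · exact measurable_const
  · split_ifs with h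
    · exact (sq_le_one_iff_abs_le_one _).1 (hV.sq_eq_one _ ω).le
    · simp
  · split_ifs with h
    · exact hV.mean_zero _
    · simp
  · split_ifs with h
    · have h1 := indep_iSup_of_disjoint (μ := μ) hle hV.iIndepFun.iIndep
        (S := {e ⟨j, h⟩}) (T := S j) (by
          rw [Set.disjoint_singleton_left]
          rintro ⟨i, hi, hij⟩
          rw [he hij] at hi
          exact lt_irrefl _ hi)
      simpa using h1
    · have : MeasurableSpace.comap (0 : Ω → ℝ) inferInstance = ⊥ :=
        MeasurableSpace.comap_const 0
      rw [this]
      exact indep_bot_left _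

/-! ### Correlations of randomly signed point sets -/

namespace PointSet

variable {d : ℕ} (Λ : PointSet d)

/-- The point set has density `ρ`, and the numbers of its pairs of neighbouring points in balls
grow at most like the volume. -/
structure IsRegular (ρ : ℝ≥0) : Prop where
  density : Tendsto (fun R : ℝ => ((Λ.ballPoints R).card : ℝ) /
    (volume (Metric.ball (0 : Space d) R)).toReal) atTop (𝓝 ρ)
  nearPairs_le : ∀ r : ℕ, ∃ C : ℝ, ∀ R : ℝ, 1 ≤ R → nearPairs (Λ.ballPoints R) r ≤ C * R ^ d

open Classical in
/-- A weight function, extended by `0` off the point set. -/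
noncomputable def extendReal (w : Λ.carrier → ℝ) (x : Space d) : ℝ :=
  if h : x ∈ Λ.carrier then w ⟨x, h⟩ else 0

theorem extendReal_of_mem (w : Λ.carrier → ℝ) {x : Space d} (h : x ∈ Λ.carrier) :
    Λ.extendReal w x = w ⟨x, h⟩ := by
  simp [extendReal, h]

section Signs

variable {Λ} {ρ : ℝ≥0} {Ω : Type*} [MeasurableSpace Ω] {μ : Measure Ω} [IsProbabilityMeasure μ]
  {V : Λ.carrier → Ω → ℝ}

theorem measure_exists_correlation_sq_ge_le (hV : IsSignFamily V μ) (T : ℝ) {r : ℕ}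
    {f : Space d → ℝ} {M : ℝ} (hM : ∀ z, |f z| ≤ M) (hf : ∀ z, r < ‖z‖ → f z = 0) {t : ℝ}
    (ht : 0 < t) :
    μ {ω | ∃ R ≤ T, t ≤ (correlation (Λ.ballPoints R) (Λ.extendReal fun x => V x ω) f -
        (Λ.ballPoints R).card * f 0) ^ 2} ≤
      ENNReal.ofReal (2 * M ^ 2 * nearPairs (Λ.ballPoints T) r / t) := by
  classical
  obtain ⟨p, hp, hpT, hpR⟩ := exists_enumeration_norm_monotone (Λ.ballPoints T)
  set N := (Λ.ballPoints T).card with hN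
  have hmem : ∀ i < N, p i ∈ Λ.carrier := by
    intro i hi
    have : p i ∈ Λ.ballPoints T := by
      rw [← hpT]
      exact Finset.mem_image_of_mem _ (Finset.mem_range.2 hi)
    exact (Λ.mem_ballPoints.1 this).1
  let e : Fin N → Λ.carrier := fun i => ⟨p i, hmem i i.2⟩
  have he : Function.Injective e := fun i j hij =>
    Fin.ext (hp i.2 j.2 (congrArg Subtype.val hij))
  obtain ⟨ℱ, hv⟩ := hV.exists_isBoundedNoise he
  set v : ℕ → Ω → ℝ := fun i => if h : i < N then V (e ⟨i, h⟩) else 0 with hvdef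
  have h1 := hv.measure_exists_quadraticChaos_sq_ge_le
    (fun a b => f (p a - p b) + f (p b - p a)) N ht
  refine le_trans (measure_mono ?_) (h1.trans (ENNReal.ofReal_le_ofReal ?_))
  · rintro ω ⟨R, hRT, hR⟩
    obtain ⟨j, hj, hjR⟩ := hpR R
    rw [Λ.filter_ballPoints hRT] at hjR
    have hcard : (Λ.ballPoints R).card = j := by
      rw [← hjR, Finset.card_image_of_injOn, Finset.card_range]
      refine hp.mono fun i hi => ?_
      simp only [Finset.coe_range, Set.mem_Iio] at hi ⊢
      lia
    refine ⟨j, hj, ?_⟩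
    rw [hcard, ← hjR, correlation_image_range hj hp (v := v) (ω := ω), add_sub_cancel_right] at hR
    · exact hR
    · intro i hi
      rw [Λ.extendReal_of_mem _ (hmem i hi)]
      exact hV.sq_eq_one _ _
    · intro i hi
      rw [Λ.extendReal_of_mem _ (hmem i hi)]
      simp [hvdef, hi, e]
  · gcongr
    have h2 := sum_sq_symmetrized_le hp hM hf
    rwa [hpT] at h2

/-- At scale `T = 2 ^ n` the second moment is `O(T ^ d)`. The threshold `T ^ d * √T` therefore gives
bad events of probability `O(T ^ (-1 / 2))`, a geometric series, and is still small against the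
squared volume. -/
theorem IsRegular.ae_tendsto_correlation_real (hd : 1 ≤ d) (hΛ : Λ.IsRegular ρ)
    (hV : IsSignFamily V μ) {r : ℕ} {f : Space d → ℝ} {M : ℝ} (hM : ∀ z, |f z| ≤ M)
    (hf : ∀ z, r < ‖z‖ → f z = 0) :
    ∀ᵐ ω ∂μ, Tendsto (fun R : ℝ =>
      correlation (Λ.ballPoints R) (Λ.extendReal fun x => V x ω) f /
        (volume (Metric.ball (0 : Space d) R)).toReal) atTop (𝓝 (ρ * f 0)) := by
  obtain ⟨C, hC⟩ := hΛ.nearPairs_le r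
  let q : Ω → ℝ → ℝ := fun ω R =>
    correlation (Λ.ballPoints R) (Λ.extendReal fun x => V x ω) f - (Λ.ballPoints R).card * f 0
  let T : ℕ → ℝ := fun n => 2 ^ n
  have hT : ∀ n, 1 ≤ T n := fun n => one_le_pow₀ (by norm_num)
  have hT0 : ∀ n, 0 < T n := fun n => one_pos.trans_le (hT n)
  let t : ℕ → ℝ := fun n => T n ^ d * √(T n)
  have ht : ∀ n, 0 < t n := fun n =>
    mul_pos (pow_pos (hT0 n) d) (Real.sqrt_pos.2 (hT0 n))
  let bad : ℕ → Set Ω := fun n => {ω | ∃ R ≤ T n, t n ≤ q ω R ^ 2}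
  have hbad : ∀ n, μ (bad n) ≤ ENNReal.ofReal (2 * M ^ 2 * C * (1 / √2) ^ n) := by
    intro n
    refine (measure_exists_correlation_sq_ge_le hV (T n) hM hf (ht n)).trans
      (ENNReal.ofReal_le_ofReal ?_)
    have hs : √(T n) = √2 ^ n := by
      rw [Real.sqrt_eq_iff_mul_self_eq (hT0 n).le (by positivity), ← mul_pow]
      simp [T]
    have h0 : 0 < T n ^ d := pow_pos (hT0 n) d
    calc 2 * M ^ 2 * nearPairs (Λ.ballPoints (T n)) r / t n
        ≤ 2 * M ^ 2 * (C * T n ^ d) / t n := by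
          have := hC (T n) (hT n)
          have := (ht n).le
          gcongr
      _ = _ := by
          simp only [t]
          rw [hs, div_pow, one_pow]
          field_simp
  have hsum : ∑' n, μ (bad n) ≠ ∞ := by
    have hC0 : 0 ≤ C := by
      have := (Nat.cast_nonneg _).trans (hC 1 le_rfl)
      simpa using this
    have hs2 : Summable fun n : ℕ => 2 * M ^ 2 * C * (1 / √2) ^ n := by
      refine (summable_geometric_of_lt_one (by positivity) ?_).mul_left _
      rw [div_lt_one (by positivity)]
      exact Real.lt_sqrt_of_sq_lt (by norm_num)
    refine ne_top_of_le_ne_top ?_ (ENNReal.tsum_le_tsum hbad)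
    rw [← ENNReal.ofReal_tsum_of_nonneg (fun n => by positivity) hs2]
    exact ENNReal.ofReal_ne_top
  filter_upwards [ae_eventually_notMem hsum] with ω hω
  have hq : ∀ᶠ R in atTop, q ω R ^ 2 ≤ 2 ^ d * √2 * (R ^ d * √R) := by
    obtain ⟨n₀, hn₀⟩ := eventually_atTop.1 hω
    filter_upwards [eventually_ge_atTop (T n₀)] with R hR
    -- `R` lies in `[2 ^ n, 2 ^ (n + 1))`. The good event at the upper end covers `R`, and `T (n +
    -- 1) ≤ 2 * R` costs the factor `2 ^ d * √2`.
    obtain ⟨n, hn1, hn2⟩ := exists_nat_pow_near ((hT n₀).trans hR) (one_lt_two (α := ℝ))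
    have hR0 : 0 ≤ R := (hT0 n₀).le.trans hR
    have hnn : n₀ ≤ n + 1 := by
      by_contra hlt
      have h3 : T (n + 1) ≤ T n₀ := pow_le_pow_right₀ (by norm_num) (by lia)
      exact absurd (hR.trans_lt hn2) (not_lt.2 h3)
    have h4 := hn₀ (n + 1) hnn
    simp only [bad, Set.mem_ofPred_eq, not_exists, not_and, not_le] at h4
    have hTR : T (n + 1) ≤ 2 * R := by
      simp only [T, pow_succ]
      linarith
    calc q ω R ^ 2 ≤ T (n + 1) ^ d * √(T (n + 1)) := (h4 R hn2.le).le
      _ ≤ (2 * R) ^ d * √(2 * R) := by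
          have := (hT0 (n + 1)).le
          gcongr
      _ = _ := by
          rw [mul_pow, Real.sqrt_mul (by norm_num)]
          ring
  have h5 := (tendsto_div_volume_ball_of_sq_le hd hq).add (hΛ.density.mul_const (f 0))
  rw [zero_add] at h5
  refine h5.congr fun R => ?_
  simp only [q]
  ring

theorem IsRegular.ae_tendsto_correlation_complex (hd : 1 ≤ d) (hΛ : Λ.IsRegular ρ)
    (hV : IsSignFamily V μ) {r : ℕ} {f : Space d → ℂ} {M : ℝ} (hM : ∀ z, ‖f z‖ ≤ M)
    (hf : ∀ z, r < ‖z‖ → f z = 0) :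
    ∀ᵐ ω ∂μ, Tendsto (fun R : ℝ =>
      correlation (Λ.ballPoints R) (Λ.extendReal fun x => V x ω) f /
        ((volume (Metric.ball (0 : Space d) R)).toReal : ℂ)) atTop (𝓝 (ρ * f 0)) := by
  filter_upwards [hΛ.ae_tendsto_correlation_real hd hV (f := fun z => (f z).re) (r := r)
      (fun z => (Complex.abs_re_le_norm _).trans (hM z)) (fun z hz => by simp [hf z hz]),
    hΛ.ae_tendsto_correlation_real hd hV (f := fun z => (f z).im) (r := r)
      (fun z => (Complex.abs_im_le_norm _).trans (hM z)) (fun z hz => by simp [hf z hz])]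
    with ω h1 h2
  have h3 := ((Complex.continuous_ofReal.tendsto _).comp h1).add
    (((Complex.continuous_ofReal.tendsto _).comp h2).mul_const Complex.I)
  have h4 : ((ρ * (f 0).re : ℝ) : ℂ) + ((ρ * (f 0).im : ℝ) : ℂ) * Complex.I = ρ * f 0 := by
    conv_rhs => rw [← Complex.re_add_im (f 0)]
    push_cast
    ring
  rw [h4] at h3
  refine h3.congr fun R => ?_
  simp only [Function.comp_apply]
  rw [← correlation_re, ← correlation_im]
  conv_rhs => rw [← Complex.re_add_im (correlation _ _ f)]
  push_cast
  ring

/-- The compact-open topology on `C(Space d, ℂ)` has a countable base, so the subspace of functions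
vanishing outside the ball is separable; convergence on that compact ball is uniform convergence
everywhere. A common radius `r` lets one pair bound serve all approximants. -/
theorem exists_countable_uniformly_dense (d r : ℕ) :
    ∃ D : Set C(Space d, ℂ), D.Countable ∧ (∀ h ∈ D, ∀ z, r < ‖z‖ → h z = 0) ∧
      ∀ g : C(Space d, ℂ), (∀ z, r < ‖z‖ → g z = 0) → ∀ ε > 0, ∃ h ∈ D, ∀ z, ‖g z - h z‖ ≤ ε := by
  let A : Set C(Space d, ℂ) := {h | ∀ z, r < ‖z‖ → h z = 0}
  obtain ⟨S, hS, hSd⟩ := TopologicalSpace.exists_countable_dense A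
  refine ⟨Subtype.val '' S, hS.image _, ?_, fun g hg ε hε => ?_⟩
  · rintro _ ⟨h, _, rfl⟩
    exact h.2
  have h1 : ∀ᶠ h in 𝓝 g, ∀ z ∈ Metric.closedBall (0 : Space d) r, dist (g z) (h z) < ε := by
    have h2 := ContinuousMap.tendsto_iff_forall_isCompact_tendstoUniformlyOn.1
      (tendsto_id (x := 𝓝 g)) _ (isCompact_closedBall (0 : Space d) (r : ℝ))
    exact Metric.tendstoUniformlyOn_iff.1 h2 ε hε
  have h3 : ∀ᶠ h in 𝓝 (⟨g, hg⟩ : A), ∀ z ∈ Metric.closedBall (0 : Space d) r,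
      dist (g z) (h.1 z) < ε := (continuous_subtype_val.tendsto (⟨g, hg⟩ : A)).eventually h1
  obtain ⟨h, hh, hhS⟩ := mem_closure_iff_nhds.1 (hSd ⟨g, hg⟩) _ h3
  refine ⟨h.1, ⟨h, hhS, rfl⟩, fun z => ?_⟩
  rcases le_or_gt ‖z‖ r with hz | hz
  · rw [← dist_eq_norm]
    exact (hh z (by simpa using hz)).le
  · rw [hg z hz, h.2 z hz]
    simpa using hε.le

theorem IsRegular.tendsto_correlation_of_approx (hΛ : Λ.IsRegular ρ) {u : Space d → ℝ}
    (hu : ∀ x, |u x| ≤ 1) {r : ℕ} {g : Space d → ℂ} (hg : ∀ z, r < ‖z‖ → g z = 0)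
    (happ : ∀ ε > 0, ∃ h : Space d → ℂ, (∀ z, r < ‖z‖ → h z = 0) ∧ (∀ z, ‖g z - h z‖ ≤ ε) ∧
      Tendsto (fun R : ℝ => correlation (Λ.ballPoints R) u h /
        ((volume (Metric.ball (0 : Space d) R)).toReal : ℂ)) atTop (𝓝 (ρ * h 0))) :
    Tendsto (fun R : ℝ => correlation (Λ.ballPoints R) u g /
      ((volume (Metric.ball (0 : Space d) R)).toReal : ℂ)) atTop (𝓝 (ρ * g 0)) := by
  obtain ⟨C, hC⟩ := hΛ.nearPairs_le r
  set v := (volume (Metric.ball (0 : Space d) 1)).toReal with hv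
  have hv0 : 0 < v := volume_unitBall_toReal_pos
  have hC0 : 0 ≤ C := by
    have := (Nat.cast_nonneg _).trans (hC 1 le_rfl)
    simpa using this
  rw [Metric.tendsto_nhds]
  intro δ hδ
  -- Replacing `g` by `h` costs `ε * C / v` in the correlation and `ε * ρ` in the limit; the `1`
  -- keeps the divisor positive.
  have hK : 0 < C / v + ρ + 1 := by positivity
  obtain ⟨h, hh0, hgh, hlim⟩ := happ (δ / 2 / (C / v + ρ + 1)) (by positivity)
  set ε := δ / 2 / (C / v + ρ + 1) with hε
  have hε0 : 0 < ε := by positivity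
  have hεK : ε * (C / v + ρ + 1) = δ / 2 := div_mul_cancel₀ _ hK.ne'
  filter_upwards [Metric.tendsto_nhds.1 hlim (δ / 2) (by positivity), eventually_ge_atTop 1]
    with R hR hR1
  have hR0 : 0 < R := by linarith
  have hRd : 0 < R ^ d := by positivity
  have hvol : (volume (Metric.ball (0 : Space d) R)).toReal = R ^ d * v := volume_ball_toReal hR0
  rw [hvol] at hR ⊢
  have h1 : ‖correlation (Λ.ballPoints R) u g / ((R ^ d * v : ℝ) : ℂ) -
      correlation (Λ.ballPoints R) u h / ((R ^ d * v : ℝ) : ℂ)‖ ≤ ε * (C / v) := by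
    rw [← sub_div, correlation_sub, norm_div, Complex.norm_real,
      Real.norm_of_nonneg (by positivity), div_le_iff₀ (by positivity)]
    refine (norm_correlation_le (r := r) _ (fun x _ => hu x) hgh
      (fun z hz => by rw [hg z hz, hh0 z hz, sub_zero])).trans ?_
    calc ε * nearPairs (Λ.ballPoints R) r ≤ ε * (C * R ^ d) := by
          gcongr; exact hC R hR1
      _ = ε * (C / v) * (R ^ d * v) := by field_simp
  have h2 : ‖(ρ : ℂ) * h 0 - ρ * g 0‖ ≤ ε * ρ := by
    rw [← mul_sub, norm_mul, norm_sub_rev, mul_comm]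
    have : ‖(ρ : ℂ)‖ = ρ := by simp
    rw [this]
    gcongr
    exact hgh 0
  rw [dist_eq_norm] at hR ⊢
  have h3 := norm_add₃_le
    (a := correlation (Λ.ballPoints R) u g / ((R ^ d * v : ℝ) : ℂ) -
      correlation (Λ.ballPoints R) u h / ((R ^ d * v : ℝ) : ℂ))
    (b := correlation (Λ.ballPoints R) u h / ((R ^ d * v : ℝ) : ℂ) - ρ * h 0)
    (c := (ρ : ℂ) * h 0 - ρ * g 0)
  rw [sub_add_sub_cancel, sub_add_sub_cancel] at h3
  nlinarith

/-- The exceptional null set may not depend on `g`: it is taken as a countable union over the radii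
`r` and the dense families `D r`. The passage to arbitrary `g` is then deterministic. -/
theorem IsRegular.ae_forall_tendsto_correlation (hd : 1 ≤ d) (hΛ : Λ.IsRegular ρ)
    (hV : IsSignFamily V μ) :
    ∀ᵐ ω ∂μ, ∀ g : C_c(Space d, ℂ), Tendsto (fun R : ℝ =>
      correlation (Λ.ballPoints R) (Λ.extendReal fun x => V x ω) g /
        ((volume (Metric.ball (0 : Space d) R)).toReal : ℂ)) atTop (𝓝 (ρ * g 0)) := by
  choose D hDc hD0 hDd using exists_countable_uniformly_dense d
  have hae : ∀ᵐ ω ∂μ, ∀ r : ℕ, ∀ h ∈ D r, Tendsto (fun R : ℝ =>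
      correlation (Λ.ballPoints R) (Λ.extendReal fun x => V x ω) h /
        ((volume (Metric.ball (0 : Space d) R)).toReal : ℂ)) atTop (𝓝 (ρ * h 0)) := by
    rw [ae_all_iff]
    intro r
    rw [ae_ball_iff (hDc r)]
    intro h hh
    have hcs : HasCompactSupport h :=
      HasCompactSupport.of_support_subset_isCompact (isCompact_closedBall (0 : Space d) (r : ℝ))
        fun z hz => by
          by_contra hzr
          exact hz (hD0 r h hh z (by simpa using hzr))
    obtain ⟨M, hM⟩ := hcs.exists_bound_of_continuous h.continuous
    exact hΛ.ae_tendsto_correlation_complex hd hV hM (hD0 r h hh)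
  filter_upwards [hae] with ω hω g
  obtain ⟨B, hB⟩ := g.hasCompactSupport'.isCompact.isBounded.exists_norm_le
  obtain ⟨r, hr⟩ := exists_nat_ge B
  have hg : ∀ z, r < ‖z‖ → g z = 0 := by
    intro z hz
    by_contra hne
    exact absurd ((hB z (subset_tsupport _ hne)).trans hr) (not_le.2 hz)
  refine hΛ.tendsto_correlation_of_approx (fun x => ?_) hg fun ε hε => ?_
  · unfold extendReal
    split_ifs
    · exact (sq_le_one_iff_abs_le_one _).1 (hV.sq_eq_one _ ω).le
    · simp
  · obtain ⟨h, hh, hgh⟩ := hDd r g.toContinuousMap hg ε hε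
    exact ⟨h, hD0 r h hh, hgh, hω r h hh⟩

end Signs

end PointSet

/-! ### Moments of the Poisson distribution -/

section PoissonMoments

variable (r : ℝ≥0)

theorem integrable_pow_poissonMeasure (k : ℕ) :
    Integrable (fun n : ℕ => (n : ℝ) ^ k) (poissonMeasure r) := by
  rw [integrable_poissonMeasure_iff]
  refine Summable.of_nonneg_of_le (fun n => by positivity) (fun n => ?_)
    ((Real.summable_pow_div_factorial ((r : ℝ) * 2 ^ k)).mul_left (Real.exp (-r)))
  -- Since `n < 2 ^ n`, the moment series is dominated by an exponential series with parameter `r *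
  -- 2 ^ k`.
  have h1 : ((n : ℝ)) ^ k ≤ (2 ^ k) ^ n := by
    rw [← pow_mul, mul_comm k n, pow_mul]
    refine pow_le_pow_left₀ (by positivity) ?_ k
    exact_mod_cast n.lt_two_pow_self.le
  rw [Real.norm_of_nonneg (by positivity), mul_pow]
  calc Real.exp (-r) * r ^ n / n.factorial * (n : ℝ) ^ k
      ≤ Real.exp (-r) * r ^ n / n.factorial * (2 ^ k) ^ n := by gcongr
    _ = _ := by ring

/-- Cancelling one factor `n` against `n!` and shifting the index; the term at zero vanishes.
Iteration gives the mean and the second moment. -/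
theorem integral_succ_pow_poissonMeasure (k : ℕ) :
    ∫ n : ℕ, (n : ℝ) ^ (k + 1) ∂poissonMeasure r =
      r * ∫ n : ℕ, ((n : ℝ) + 1) ^ k ∂poissonMeasure r := by
  have h1 := (hasSum_nat_add_iff' 1).2
    (hasSum_integral_poissonMeasure (integrable_pow_poissonMeasure r (k + 1)))
  have hint : Integrable (fun n : ℕ => ((n : ℝ) + 1) ^ k) (poissonMeasure r) := by
    simp only [add_pow, one_pow, mul_one]
    exact integrable_finsetSum _ fun i _ => (integrable_pow_poissonMeasure r i).mul_const _
  have h2 := (hasSum_integral_poissonMeasure hint).mul_left (r : ℝ)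
  simp only [Finset.range_one, Finset.sum_singleton, Nat.cast_zero, ne_eq, Nat.add_eq_zero_iff,
    one_ne_zero, and_false, not_false_eq_true, zero_pow, smul_zero, sub_zero] at h1
  refine h1.unique (h2.congr_fun ?_)
  intro n
  rw [Nat.factorial_succ]
  simp only [smul_eq_mul]
  push_cast
  field_simp
  ring

theorem integral_poissonMeasure_id : ∫ n : ℕ, (n : ℝ) ∂poissonMeasure r = r := by
  simpa using integral_succ_pow_poissonMeasure r 0

theorem integral_sq_poissonMeasure : ∫ n : ℕ, (n : ℝ) ^ 2 ∂poissonMeasure r = r * (r + 1) := by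
  have h1 : Integrable (fun n : ℕ => (n : ℝ)) (poissonMeasure r) := by
    simpa using integrable_pow_poissonMeasure r 1
  have h := integral_succ_pow_poissonMeasure r 1
  simp only [pow_one] at h
  rw [h, integral_add h1 (integrable_const _), integral_poissonMeasure_id]
  simp

theorem memLp_pow_poissonMeasure (k : ℕ) :
    MemLp (fun n : ℕ => (n : ℝ) ^ k) 2 (poissonMeasure r) := by
  rw [memLp_two_iff_integrable_sq (measurable_of_countable _).aestronglyMeasurable]
  simpa only [← pow_mul] using integrable_pow_poissonMeasure r (k * 2)

theorem variance_poissonMeasure : Var[fun n : ℕ => (n : ℝ); poissonMeasure r] = r := by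
  have h := memLp_pow_poissonMeasure r 1
  simp only [pow_one] at h
  rw [variance_eq_sub h]
  simp only [Pi.pow_apply, integral_sq_poissonMeasure, integral_poissonMeasure_id]
  ring

end PoissonMoments

/-- Chebyshev's inequality together with the Borel-Cantelli lemma. -/
theorem ae_eventually_abs_sub_integral_lt {Ω : Type*} [MeasurableSpace Ω] {μ : Measure Ω}
    [IsFiniteMeasure μ] {Y : ℕ → Ω → ℝ} (hY : ∀ n, MemLp (Y n) 2 μ) {b : ℕ → ℝ}
    (hb : ∀ n, 0 < b n) (hs : Summable fun n => Var[Y n; μ] / b n ^ 2) :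
    ∀ᵐ ω ∂μ, ∀ᶠ n in atTop, |Y n ω - ∫ ω', Y n ω' ∂μ| < b n := by
  have hsum : ∑' n, μ {ω | b n ≤ |Y n ω - ∫ ω', Y n ω' ∂μ|} ≠ ∞ := by
    refine ne_top_of_le_ne_top ?_
      (ENNReal.tsum_le_tsum fun n => meas_ge_le_variance_div_sq (hY n) (hb n))
    rw [← ENNReal.ofReal_tsum_of_nonneg
      (fun n => div_nonneg (variance_nonneg _ _) (sq_nonneg _)) hs]
    exact ENNReal.ofReal_ne_top
  filter_upwards [ae_eventually_notMem hsum] with ω hω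
  filter_upwards [hω] with n hn
  simpa using hn

/-! ### Unit cubes -/

section Cubes

variable {d : ℕ}

/-- The integer parts of the coordinates of a vector. -/
noncomputable def floorVec (x : Space d) : Fin d → ℤ := fun i => ⌊x i⌋

/-- The half-open unit cube with lowest corner `k`. -/
def unitCube (k : Fin d → ℤ) : Set (Space d) := {x | floorVec x = k}

theorem measurable_floorVec : Measurable (floorVec : Space d → Fin d → ℤ) := by
  refine measurable_pi_lambda _ fun i => Int.measurable_floor.comp ?_
  fun_prop

theorem measurableSet_unitCube (k : Fin d → ℤ) : MeasurableSet (unitCube k) :=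
  measurable_floorVec (measurableSet_singleton k)

theorem disjoint_unitCube {k l : Fin d → ℤ} (h : k ≠ l) : Disjoint (unitCube k) (unitCube l) := by
  rw [Set.disjoint_left]
  intro x hk hl
  exact h (hk.symm.trans hl)

theorem volume_unitCube (k : Fin d → ℤ) : volume (unitCube k) = 1 := by
  have h : unitCube k = (WithLp.ofLp : Space d → Fin d → ℝ) ⁻¹'
      (Set.univ.pi fun i => Set.Ico (k i : ℝ) (k i + 1)) := by
    ext x
    simp [unitCube, floorVec, funext_iff, Int.floor_eq_iff]
  rw [h, (PiLp.volume_preserving_ofLp (Fin d)).measure_preimage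
    (MeasurableSet.univ_pi fun i => measurableSet_Ico).nullMeasurableSet, Real.volume_pi_Ico]
  simp

/-- Boundedness ensures that a cube contains finitely many points, so that `natCount` of a cube is a
true count and not the default value at infinity. -/
theorem exists_unitCube_subset_ball (k : Fin d → ℤ) :
    ∃ R : ℝ, unitCube k ⊆ Metric.ball 0 R := by
  refine ⟨√(∑ i, (|(k i : ℝ)| + 1) ^ 2) + 1, fun x hx => ?_⟩
  rw [mem_ball_zero_iff]
  refine lt_of_le_of_lt ?_ (lt_add_one _)
  rw [EuclideanSpace.norm_eq]
  refine Real.sqrt_le_sqrt (Finset.sum_le_sum fun i _ => ?_)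
  refine pow_le_pow_left₀ (norm_nonneg _) ?_ 2
  have hi : ⌊x i⌋ = k i := congrFun hx i
  rw [Int.floor_eq_iff] at hi
  rw [Real.norm_eq_abs, abs_le]
  constructor
  · linarith [neg_abs_le (k i : ℝ)]
  · linarith [le_abs_self (k i : ℝ)]

/-- The lower corners of the unit cubes that make up the cube `[-T, T)^d`. -/
noncomputable def cornerBox (d T : ℕ) : Finset (Fin d → ℤ) :=
  Fintype.piFinset fun _ => Finset.Ico (-(T : ℤ)) T

theorem card_cornerBox (d T : ℕ) : (cornerBox d T).card = (2 * T) ^ d := by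
  rw [cornerBox, Fintype.card_piFinset_const, Int.card_Ico]
  congr 1
  lia

theorem abs_apply_le_norm (x : Space d) (i : Fin d) : |x i| ≤ ‖x‖ :=
  PiLp.norm_apply_le x i

theorem floorVec_mem_cornerBox {T : ℕ} {x : Space d} (hx : ‖x‖ < T) :
    floorVec x ∈ cornerBox d T := by
  rw [cornerBox, Fintype.mem_piFinset]
  intro i
  have h := abs_lt.1 ((abs_apply_le_norm x i).trans_lt hx)
  rw [Finset.mem_Ico, floorVec, Int.le_floor, Int.floor_lt]
  push_cast
  exact ⟨h.1.le, h.2⟩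

/-- The corners of the cubes of two near points differ by a vector `δ` in `[-r, r] ^ d`, which has
`(2 * r + 1) ^ d` integer values. For each `δ`, the sum of `n k * n (k + δ)` is at most the sum of
`n k ^ 2` by the arithmetic-geometric mean inequality. What remains is a sum over disjoint cubes,
where independence applies. -/
theorem nearPairs_le_sum_sq (s : Finset (Space d)) {B : Finset (Fin d → ℤ)}
    (hB : ∀ x ∈ s, floorVec x ∈ B) (r : ℕ) :
    nearPairs s r ≤ (2 * r + 1) ^ d * ∑ k ∈ B, (s.filter (floorVec · = k)).card ^ 2 := by
  classical
  let n : (Fin d → ℤ) → ℕ := fun k => (s.filter (floorVec · = k)).card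
  let Δ : Finset (Fin d → ℤ) := Fintype.piFinset fun _ => Finset.Icc (-(r : ℤ)) r
  have hΔ : Δ.card = (2 * r + 1) ^ d := by
    rw [Fintype.card_piFinset_const, Int.card_Icc]
    congr 1
    lia
  have hsub : ((s ×ˢ s).filter fun z => ‖z.1 - z.2‖ ≤ r) ⊆
      Δ.biUnion fun δ => (s ×ˢ s).filter fun z => floorVec z.2 = floorVec z.1 + δ := by
    rintro ⟨x, y⟩ hz
    simp only [Finset.mem_filter, Finset.mem_product, Finset.mem_biUnion] at hz ⊢
    refine ⟨floorVec y - floorVec x, ?_, hz.1, by simp⟩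
    rw [Fintype.mem_piFinset]
    intro i
    have h := abs_le.1 ((abs_apply_le_norm (x - y) i).trans hz.2)
    rw [PiLp.sub_apply] at h
    have hx1 := Int.floor_le (x i)
    have hx2 := Int.lt_floor_add_one (x i)
    have hy1 := Int.floor_le (y i)
    have hy2 := Int.lt_floor_add_one (y i)
    rw [Finset.mem_Icc, Pi.sub_apply, floorVec, floorVec]
    constructor
    · have : (-(r : ℤ) : ℝ) < ⌊y i⌋ - ⌊x i⌋ + 1 := by push_cast; linarith
      have : -(r : ℤ) < ⌊y i⌋ - ⌊x i⌋ + 1 := by exact_mod_cast this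
      lia
    · have : (⌊y i⌋ - ⌊x i⌋ : ℝ) < (r : ℤ) + 1 := by push_cast; linarith
      have : ⌊y i⌋ - ⌊x i⌋ < (r : ℤ) + 1 := by exact_mod_cast this
      lia
  have hshift : ∀ δ, ((s ×ˢ s).filter fun z => floorVec z.2 = floorVec z.1 + δ).card ≤
      ∑ k ∈ B, n k ^ 2 := by
    intro δ
    have h1 : ((s ×ˢ s).filter fun z => floorVec z.2 = floorVec z.1 + δ).card =
        ∑ k ∈ B, n k * n (k + δ) := by
      rw [Finset.card_filter, Finset.sum_product, ← Finset.sum_fiberwise_of_maps_to hB]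
      refine Finset.sum_congr rfl fun k _ => ?_
      rw [Finset.sum_congr rfl (g := fun _ => n (k + δ)), Finset.sum_const, smul_eq_mul]
      intro x hx
      rw [← Finset.card_filter, ← (Finset.mem_filter.1 hx).2]
    have h2 : ∑ k ∈ B, n (k + δ) ^ 2 ≤ ∑ k ∈ B, n k ^ 2 := by
      refine (Finset.sum_map B (Equiv.addRight δ).toEmbedding fun k => n k ^ 2).symm.trans_le ?_
      -- The shifted box may leave `B`, but `n` vanishes off `B`.
      refine Finset.sum_le_sum_of_ne_zero fun k _ hk => ?_
      have hpos : 0 < n k := Nat.pos_of_ne_zero fun h0 => hk (by rw [h0, sq, zero_mul])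
      obtain ⟨x, hx⟩ := Finset.card_pos.1 hpos
      rw [Finset.mem_filter] at hx
      rw [← hx.2]
      exact hB x hx.1
    have h3 : 2 * ∑ k ∈ B, n k * n (k + δ) ≤ ∑ k ∈ B, n k ^ 2 + ∑ k ∈ B, n (k + δ) ^ 2 := by
      rw [Finset.mul_sum, ← Finset.sum_add_distrib]
      refine Finset.sum_le_sum fun k _ => ?_
      rw [← mul_assoc]
      exact two_mul_le_add_sq _ _
    rw [h1]
    linarith
  calc nearPairs s r ≤ _ := Finset.card_le_card hsub
    _ ≤ ∑ δ ∈ Δ, _ := Finset.card_biUnion_le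
    _ ≤ ∑ δ ∈ Δ, ∑ k ∈ B, n k ^ 2 := Finset.sum_le_sum fun δ _ => hshift δ
    _ = _ := by rw [Finset.sum_const, hΔ, smul_eq_mul]

end Cubes

/-! ### Poisson processes are regular -/

namespace PointSet

variable {d : ℕ} (Λ : PointSet d)

/-- The number of points of `Λ` in a set that contains finitely many of them. -/
noncomputable def natCount (A : Set (Space d)) : ℕ := (Λ.count A).toNat

theorem natCount_ball (R : ℝ) : Λ.natCount (Metric.ball 0 R) = (Λ.ballPoints R).card := by
  rw [natCount, count, ← (Λ.finite_inter_ball R).cast_ncard_eq, ENat.toNat_natCast,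
    Set.ncard_eq_toFinset_card _ (Λ.finite_inter_ball R), ballPoints]

theorem card_filter_ballPoints_le (R : ℝ) (k : Fin d → ℤ) :
    ((Λ.ballPoints R).filter (floorVec · = k)).card ≤ Λ.natCount (unitCube k) := by
  obtain ⟨T, hT⟩ := exists_unitCube_subset_ball k
  have hfin : (Λ.carrier ∩ unitCube k).Finite :=
    (Λ.finite_inter_ball T).subset (Set.inter_subset_inter_right _ hT)
  rw [natCount, count, ← hfin.cast_ncard_eq, ENat.toNat_natCast, ← Set.ncard_coe_finset]
  refine Set.ncard_le_ncard (fun x hx => ?_) hfin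
  simp only [Finset.coe_filter, Set.mem_ofPred_eq, mem_ballPoints] at hx
  exact ⟨hx.1.1, hx.2⟩

theorem exists_nearPairs_le {K : ℝ}
    (h : ∀ᶠ n : ℕ in atTop, (∑ k ∈ cornerBox d (2 ^ n), (Λ.natCount (unitCube k) : ℝ) ^ 2) ≤
      K * (2 * 2 ^ n) ^ d) (r : ℕ) :
    ∃ C : ℝ, ∀ R : ℝ, 1 ≤ R → nearPairs (Λ.ballPoints R) r ≤ C * R ^ d := by
  obtain ⟨n₀, hn₀⟩ := eventually_atTop.1 h
  have hn : ∀ n ≥ n₀, (nearPairs (Λ.ballPoints (2 ^ n)) r : ℝ) ≤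
      (2 * r + 1) ^ d * (K * (2 * 2 ^ n) ^ d) := by
    intro n hn
    have h1 := nearPairs_le_sum_sq (Λ.ballPoints (2 ^ n)) (B := cornerBox d (2 ^ n))
      (fun x hx => floorVec_mem_cornerBox (by simpa using (Λ.mem_ballPoints.1 hx).2)) r
    have h2 : (nearPairs (Λ.ballPoints (2 ^ n)) r : ℝ) ≤ (2 * r + 1) ^ d *
        ∑ k ∈ cornerBox d (2 ^ n),
          (((Λ.ballPoints (2 ^ n)).filter (floorVec · = k)).card : ℝ) ^ 2 := by
      exact_mod_cast h1
    refine h2.trans ?_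
    gcongr
    refine le_trans (Finset.sum_le_sum fun k _ => ?_) (hn₀ n hn)
    gcongr
    exact Λ.card_filter_ballPoints_le _ k
  have hK : 0 ≤ K := by
    have h1 : (0 : ℝ) ≤ K * (2 * 2 ^ n₀) ^ d :=
      (Finset.sum_nonneg fun k _ => sq_nonneg _).trans (hn₀ n₀ le_rfl)
    exact nonneg_of_mul_nonneg_left h1 (by positivity)
  -- The first summand covers `R ≤ 2 ^ n₀`. Beyond that, `2 * 2 ^ (n + 1) ≤ 4 * R` at the next
  -- dyadic scale explains `4 ^ d`.
  refine ⟨nearPairs (Λ.ballPoints (2 ^ n₀)) r + (2 * r + 1) ^ d * (K * 4 ^ d), fun R hR => ?_⟩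
  have hR1 : 1 ≤ R ^ d := one_le_pow₀ hR
  rcases le_total R (2 ^ n₀) with hRn | hRn
  · have h1 : (nearPairs (Λ.ballPoints R) r : ℝ) ≤ nearPairs (Λ.ballPoints (2 ^ n₀)) r := by
      exact_mod_cast nearPairs_mono (Λ.ballPoints_mono hRn) r
    have h2 : (0 : ℝ) ≤ (2 * r + 1) ^ d * (K * 4 ^ d) := by positivity
    nlinarith [(Nat.cast_nonneg (nearPairs (Λ.ballPoints (2 ^ n₀)) r) : (0 : ℝ) ≤ _)]
  · obtain ⟨n, hn1, hn2⟩ := exists_nat_pow_near hR (one_lt_two (α := ℝ))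
    have hnn : n₀ ≤ n + 1 := by
      by_contra hlt
      have h3 : (2 : ℝ) ^ (n + 1) ≤ 2 ^ n₀ := pow_le_pow_right₀ (by norm_num) (by lia)
      exact absurd (hRn.trans_lt hn2) (not_lt.2 h3)
    have h1 : (nearPairs (Λ.ballPoints R) r : ℝ) ≤ nearPairs (Λ.ballPoints (2 ^ (n + 1))) r := by
      exact_mod_cast nearPairs_mono (Λ.ballPoints_mono hn2.le) r
    have h2 : (2 * 2 ^ (n + 1) : ℝ) ^ d ≤ (4 * R) ^ d := by
      refine pow_le_pow_left₀ (by positivity) ?_ d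
      rw [pow_succ]
      linarith
    calc (nearPairs (Λ.ballPoints R) r : ℝ)
        ≤ (2 * r + 1) ^ d * (K * (2 * 2 ^ (n + 1)) ^ d) := h1.trans (hn _ hnn)
      _ ≤ (2 * r + 1) ^ d * (K * (4 * R) ^ d) := by gcongr
      _ = (2 * r + 1) ^ d * (K * 4 ^ d) * R ^ d := by rw [mul_pow]; ring
      _ ≤ _ := by
        gcongr
        exact le_add_of_nonneg_left (Nat.cast_nonneg _)

end PointSet

/-- Monotonicity squeezes `N R` between consecutive radii `m ^ 4` and `(m + 1) ^ 4`, with `m` the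
integer part of the fourth root of `R`. Their ratio tends to one, as dyadic radii would not allow,
and the error `m ^ (3 * d)` is small against `m ^ (4 * d)`. -/
theorem tendsto_div_pow_of_abs_sub_lt {d : ℕ} (hd : 1 ≤ d) {N : ℝ → ℝ} (hN0 : ∀ R, 0 ≤ N R)
    (hN : Monotone N) {a : ℝ}
    (h : ∀ᶠ n : ℕ in atTop, |N (((n : ℝ) + 1) ^ 4) - (((n : ℝ) + 1) ^ 4) ^ d * a| <
      ((n : ℝ) + 1) ^ (3 * d)) :
    Tendsto (fun R : ℝ => N R / R ^ d) atTop (𝓝 a) := by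
  have hlim : Tendsto (fun m : ℕ => ((m : ℝ) + 1) / m) atTop (𝓝 1) := by
    have h1 : Tendsto (fun m : ℕ => 1 + 1 / (m : ℝ)) atTop (𝓝 (1 + 0)) :=
      tendsto_const_nhds.add tendsto_one_div_atTop_nhds_zero_nat
    rw [add_zero] at h1
    refine h1.congr' ?_
    filter_upwards [eventually_ge_atTop 1] with m hm
    have : (m : ℝ) ≠ 0 := by positivity
    field_simp
  have hlim' : Tendsto (fun m : ℕ => (m : ℝ) / (m + 1)) atTop (𝓝 1) := by
    simpa using hlim.inv₀ one_ne_zero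
  have hzero : Tendsto (fun m : ℕ => 1 / (m : ℝ) ^ d) atTop (𝓝 0) := by
    have h1 := tendsto_one_div_atTop_nhds_zero_nat (𝕜 := ℝ).pow d
    rw [zero_pow (by lia)] at h1
    simpa using h1
  have hU : Tendsto (fun m : ℕ => a * (((m : ℝ) + 1) / m) ^ (4 * d) +
      (((m : ℝ) + 1) / m) ^ (3 * d) * (1 / (m : ℝ) ^ d)) atTop (𝓝 a) := by
    simpa using ((hlim.pow (4 * d)).const_mul a).add ((hlim.pow (3 * d)).mul hzero)
  have hL : Tendsto (fun m : ℕ => a * ((m : ℝ) / (m + 1)) ^ (4 * d) -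
      ((m : ℝ) / (m + 1)) ^ (4 * d) * (1 / (m : ℝ) ^ d)) atTop (𝓝 a) := by
    simpa using ((hlim'.pow (4 * d)).const_mul a).sub ((hlim'.pow (4 * d)).mul hzero)
  have hroot : Tendsto (fun R : ℝ => ⌊√(√R)⌋₊) atTop atTop :=
    tendsto_nat_floor_atTop.comp (Real.tendsto_sqrt_atTop.comp Real.tendsto_sqrt_atTop)
  obtain ⟨n₀, hn₀⟩ := eventually_atTop.1 h
  have hN₀ : ∀ m : ℕ, n₀ + 1 ≤ m →
      |N ((m : ℝ) ^ 4) - ((m : ℝ) ^ 4) ^ d * a| < (m : ℝ) ^ (3 * d) := by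
    intro m hm
    obtain ⟨n, rfl⟩ : ∃ n, m = n + 1 := ⟨m - 1, by lia⟩
    simpa using hn₀ n (by lia)
  have hbounds : ∀ᶠ R : ℝ in atTop, ∃ m : ℕ, m = ⌊√(√R)⌋₊ ∧ n₀ + 1 ≤ m ∧ (m : ℝ) ^ 4 ≤ R ∧
      R ≤ ((m : ℝ) + 1) ^ 4 := by
    filter_upwards [hroot.eventually_ge_atTop (n₀ + 1), eventually_ge_atTop 0] with R hm hR
    refine ⟨_, rfl, hm, ?_, ?_⟩
    · have h1 := Nat.floor_le (Real.sqrt_nonneg √R)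
      calc _ ≤ (√(√R)) ^ 4 := by gcongr
        _ = ((√(√R)) ^ 2) ^ 2 := by ring
        _ = R := by rw [Real.sq_sqrt (Real.sqrt_nonneg R), Real.sq_sqrt hR]
    · have h1 := (Nat.lt_floor_add_one √(√R)).le
      calc R = ((√(√R)) ^ 2) ^ 2 := by rw [Real.sq_sqrt (Real.sqrt_nonneg R), Real.sq_sqrt hR]
        _ = (√(√R)) ^ 4 := by ring
        _ ≤ _ := by gcongr
  refine tendsto_of_tendsto_of_tendsto_of_le_of_le' (hL.comp hroot) (hU.comp hroot) ?_ ?_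
  · filter_upwards [hbounds, eventually_gt_atTop 0] with R ⟨m, hm, hm0, h1, h2⟩ hR
    rw [Function.comp_apply, ← hm]
    have hx : (0 : ℝ) < m := Nat.cast_pos.2 (by lia)
    have h3 : ((m : ℝ) ^ 4) ^ d * a - (m : ℝ) ^ (3 * d) ≤ N R := by
      have := (abs_lt.1 (hN₀ m hm0)).1
      linarith [hN h1]
    generalize (m : ℝ) = x at *
    calc a * (x / (x + 1)) ^ (4 * d) - (x / (x + 1)) ^ (4 * d) * (1 / x ^ d)
        = ((x ^ 4) ^ d * a - x ^ (3 * d)) / ((x + 1) ^ 4) ^ d := by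
          have h4 : x ^ (4 * d) = x ^ (3 * d) * x ^ d := by ring
          rw [div_pow, ← pow_mul, ← pow_mul, h4]
          field_simp
      _ ≤ N R / ((x + 1) ^ 4) ^ d := by gcongr
      _ ≤ N R / R ^ d := by
          have := hN0 R
          gcongr
  · filter_upwards [hbounds, eventually_gt_atTop 0] with R ⟨m, hm, hm0, h1, h2⟩ hR
    rw [Function.comp_apply, ← hm]
    have hx : (0 : ℝ) < m := Nat.cast_pos.2 (by lia)
    have h3 : N (((m : ℝ) + 1) ^ 4) ≤ (((m : ℝ) + 1) ^ 4) ^ d * a + ((m : ℝ) + 1) ^ (3 * d) := by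
      have := (abs_lt.1 (hn₀ m (by lia))).2
      linarith
    generalize (m : ℝ) = x at *
    calc N R / R ^ d ≤ N ((x + 1) ^ 4) / (x ^ 4) ^ d := by
          have := hN0 ((x + 1) ^ 4)
          have := hN h2
          gcongr
      _ ≤ (((x + 1) ^ 4) ^ d * a + (x + 1) ^ (3 * d)) / (x ^ 4) ^ d := by gcongr
      _ = a * ((x + 1) / x) ^ (4 * d) + ((x + 1) / x) ^ (3 * d) * (1 / x ^ d) := by
          have h4 : x ^ (4 * d) = x ^ (3 * d) * x ^ d := by ring
          rw [div_pow, div_pow, ← pow_mul, ← pow_mul, h4]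
          field_simp

namespace IsPoissonProcess

variable {Ω : Type*} [MeasurableSpace Ω] {P : Measure Ω} {d : ℕ}
  {ρ : ℝ≥0} {Λ : Ω → PointSet d}

theorem hasLaw_natCount (hΛ : IsPoissonProcess ρ Λ P) {A : Set (Space d)} (hA : MeasurableSet A)
    (hA' : volume A ≠ ∞) :
    HasLaw (fun ξ => (Λ ξ).natCount A) (poissonMeasure (ρ * (volume A).toNNReal)) P := by
  have h1 : HasLaw ENat.toNat (poissonMeasure (ρ * (volume A).toNNReal))
      ((poissonMeasure (ρ * (volume A).toNNReal)).map (Nat.cast : ℕ → ℕ∞)) := by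
    refine ⟨(measurable_of_countable _).aemeasurable, ?_⟩
    rw [Measure.map_map (measurable_of_countable _) (measurable_of_countable _)]
    have : ENat.toNat ∘ (Nat.cast : ℕ → ℕ∞) = id := by ext n; simp
    rw [this, Measure.map_id]
  exact h1.fun_comp (hΛ.hasLaw_count A hA hA')

theorem indepFun_natCount (hΛ : IsPoissonProcess ρ Λ P) {A B : Set (Space d)}
    (hA : MeasurableSet A) (hB : MeasurableSet B) (hAB : Disjoint A B) :
    IndepFun (fun ξ => (Λ ξ).natCount A) (fun ξ => (Λ ξ).natCount B) P := by
  have h := hΛ.iIndepFun_count 2 ![A, B] (by simp [Fin.forall_fin_two, hA, hB]) (by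
    intro i j hij
    fin_cases i <;> fin_cases j <;> simp_all [disjoint_comm])
  exact (h.indepFun (i := 0) (j := 1) (by simp)).comp (φ := ENat.toNat) (ψ := ENat.toNat)
    (measurable_of_countable _) (measurable_of_countable _)

theorem memLp_natCount_pow (hΛ : IsPoissonProcess ρ Λ P) {A : Set (Space d)}
    (hA : MeasurableSet A) (hA' : volume A ≠ ∞) (k : ℕ) :
    MemLp (fun ξ => ((Λ ξ).natCount A : ℝ) ^ k) 2 P := by
  have hlaw := hΛ.hasLaw_natCount hA hA'
  have h := memLp_pow_poissonMeasure (ρ * (volume A).toNNReal) k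
  rw [← hlaw.map_eq] at h
  exact h.comp_of_map hlaw.aemeasurable

theorem integral_natCount_pow (hΛ : IsPoissonProcess ρ Λ P) {A : Set (Space d)}
    (hA : MeasurableSet A) (hA' : volume A ≠ ∞) (k : ℕ) :
    ∫ ξ, ((Λ ξ).natCount A : ℝ) ^ k ∂P =
      ∫ n : ℕ, (n : ℝ) ^ k ∂poissonMeasure (ρ * (volume A).toNNReal) :=
  (hΛ.hasLaw_natCount hA hA').integral_comp (f := fun n : ℕ => (n : ℝ) ^ k)
    (measurable_of_countable _).aestronglyMeasurable

theorem variance_natCount_pow (hΛ : IsPoissonProcess ρ Λ P) {A : Set (Space d)}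
    (hA : MeasurableSet A) (hA' : volume A ≠ ∞) (k : ℕ) :
    Var[fun ξ => ((Λ ξ).natCount A : ℝ) ^ k; P] =
      Var[fun n : ℕ => (n : ℝ) ^ k; poissonMeasure (ρ * (volume A).toNNReal)] := by
  have hlaw := hΛ.hasLaw_natCount hA hA'
  rw [← hlaw.map_eq, variance_map (measurable_of_countable _).aemeasurable hlaw.aemeasurable]
  rfl

variable [IsProbabilityMeasure P]

/-- At radius `(n + 1) ^ 4` the variance is of order `(n + 1) ^ (4 * d)`. With deviation `(n + 1) ^
(3 * d)` Chebyshev gives `(n + 1) ^ (-2 * d)`, which is summable. -/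
theorem ae_tendsto_density (hd : 1 ≤ d) (hΛ : IsPoissonProcess ρ Λ P) :
    ∀ᵐ ξ ∂P, Tendsto (fun R : ℝ => (((Λ ξ).ballPoints R).card : ℝ) /
      (volume (Metric.ball (0 : Space d) R)).toReal) atTop (𝓝 ρ) := by
  set v := (volume (Metric.ball (0 : Space d) 1)).toReal with hv
  have hv0 : 0 < v := volume_unitBall_toReal_pos
  let T : ℕ → ℝ := fun n => ((n : ℝ) + 1) ^ 4
  have hT : ∀ n, 0 < T n := fun n => by positivity
  have hvol : ∀ n, ((ρ * (volume (Metric.ball (0 : Space d) (T n))).toNNReal : ℝ≥0) : ℝ) =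
      T n ^ d * (ρ * v) := by
    intro n
    rw [NNReal.coe_mul, ENNReal.coe_toNNReal_eq_toReal, volume_ball_toReal (hT n)]
    ring
  have hmem : ∀ n, MemLp (fun ξ => ((Λ ξ).natCount (Metric.ball 0 (T n)) : ℝ)) 2 P := fun n => by
    simpa using hΛ.memLp_natCount_pow measurableSet_ball measure_ball_lt_top.ne 1
  have hmean : ∀ n, ∫ ξ, ((Λ ξ).natCount (Metric.ball 0 (T n)) : ℝ) ∂P = T n ^ d * (ρ * v) := by
    intro n
    have h1 := hΛ.integral_natCount_pow (A := Metric.ball 0 (T n)) measurableSet_ball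
      measure_ball_lt_top.ne 1
    simp only [pow_one] at h1
    rw [h1, integral_poissonMeasure_id, hvol]
  have hvar : ∀ n, Var[fun ξ => ((Λ ξ).natCount (Metric.ball 0 (T n)) : ℝ); P] =
      T n ^ d * (ρ * v) := by
    intro n
    have h1 := hΛ.variance_natCount_pow (A := Metric.ball 0 (T n)) measurableSet_ball
      measure_ball_lt_top.ne 1
    simp only [pow_one] at h1
    rw [h1, variance_poissonMeasure, hvol]
  have hsum : Summable fun n : ℕ =>
      Var[fun ξ => ((Λ ξ).natCount (Metric.ball 0 (T n)) : ℝ); P] /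
        (((n : ℝ) + 1) ^ (3 * d)) ^ 2 := by
    have h1 : Summable fun n : ℕ => ρ * v * (1 / ((n : ℝ) + 1) ^ 2) := by
      refine Summable.mul_left _ ?_
      exact_mod_cast (summable_nat_add_iff 1).2 (Real.summable_one_div_nat_pow.2 one_lt_two)
    refine Summable.of_nonneg_of_le
      (fun n => div_nonneg (variance_nonneg _ _) (sq_nonneg _)) (fun n => ?_) h1
    rw [hvar]
    have h2 : T n ^ d * (ρ * v) / (((n : ℝ) + 1) ^ (3 * d)) ^ 2 =
        ρ * v * (1 / ((n : ℝ) + 1) ^ (2 * d)) := by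
      have h0 : (n : ℝ) + 1 ≠ 0 := by positivity
      simp only [T]
      generalize (n : ℝ) + 1 = x at h0 ⊢
      field_simp
      ring
    rw [h2]
    gcongr
    · simp
    · lia
  filter_upwards [ae_eventually_abs_sub_integral_lt hmem (b := fun n => ((n : ℝ) + 1) ^ (3 * d))
    (fun n => by positivity) hsum] with ξ hξ
  simp only [hmean] at hξ
  simp only [PointSet.natCount_ball, T] at hξ
  have h1 := (tendsto_div_pow_of_abs_sub_lt hd (N := fun R => (((Λ ξ).ballPoints R).card : ℝ))
    (fun R => Nat.cast_nonneg _) (fun R S hRS =>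
      Nat.cast_le.2 (Finset.card_le_card ((Λ ξ).ballPoints_mono hRS))) hξ).div_const v
  rw [mul_div_cancel_right₀ _ hv0.ne'] at h1
  refine h1.congr' ?_
  filter_upwards [eventually_gt_atTop 0] with R hR
  rw [volume_ball_toReal hR, div_div]

/-- The squared cube counts have mean `ρ * (ρ + 1)`, a common finite variance and pairwise
independence. A deviation of one per cube has probability `O(2 ^ (-n * d))`, hence the `+ 1` in the
bound. -/
theorem ae_eventually_sum_natCount_sq_le (hd : 1 ≤ d) (hΛ : IsPoissonProcess ρ Λ P) :
    ∀ᵐ ξ ∂P, ∀ᶠ n : ℕ in atTop,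
      (∑ k ∈ cornerBox d (2 ^ n), ((Λ ξ).natCount (unitCube k) : ℝ) ^ 2) ≤
        (ρ * (ρ + 1) + 1) * (2 * 2 ^ n) ^ d := by
  have hone : ∀ k : Fin d → ℤ, ρ * (volume (unitCube k)).toNNReal = ρ := fun k => by
    simp [volume_unitCube]
  have hfin : ∀ k : Fin d → ℤ, volume (unitCube k) ≠ ∞ := fun k => by simp [volume_unitCube]
  let X : (Fin d → ℤ) → Ω → ℝ := fun k ξ => ((Λ ξ).natCount (unitCube k) : ℝ) ^ 2
  have hX : ∀ k, MemLp (X k) 2 P := fun k =>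
    hΛ.memLp_natCount_pow (measurableSet_unitCube k) (hfin k) 2
  set σ := Var[fun n : ℕ => (n : ℝ) ^ 2; poissonMeasure ρ] with hσ
  have hXvar : ∀ k, Var[X k; P] = σ := fun k => by
    rw [hΛ.variance_natCount_pow (measurableSet_unitCube k) (hfin k) 2, hone]
  have hXmean : ∀ k, ∫ ξ, X k ξ ∂P = ρ * (ρ + 1) := fun k => by
    rw [hΛ.integral_natCount_pow (measurableSet_unitCube k) (hfin k) 2, hone,
      integral_sq_poissonMeasure]
  have hcard : ∀ n : ℕ, ((cornerBox d (2 ^ n)).card : ℝ) = (2 * 2 ^ n) ^ d := fun n => by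
    rw [card_cornerBox]; push_cast; rfl
  have hmem : ∀ n : ℕ, MemLp (∑ k ∈ cornerBox d (2 ^ n), X k) 2 P := fun n =>
    memLp_finsetSum' _ fun k _ => hX k
  have hmean : ∀ n : ℕ, ∫ ξ, (∑ k ∈ cornerBox d (2 ^ n), X k) ξ ∂P =
      (2 * 2 ^ n) ^ d * (ρ * (ρ + 1)) := by
    intro n
    simp only [Finset.sum_apply]
    rw [integral_finsetSum _ fun k _ => (hX k).integrable one_le_two]
    simp only [hXmean, Finset.sum_const, nsmul_eq_mul, hcard]
  have hvar : ∀ n : ℕ, Var[∑ k ∈ cornerBox d (2 ^ n), X k; P] = (2 * 2 ^ n) ^ d * σ := by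
    intro n
    rw [IndepFun.variance_sum (fun k _ => hX k)]
    · simp only [hXvar, Finset.sum_const, nsmul_eq_mul, hcard]
    · intro k _ l _ hkl
      exact (hΛ.indepFun_natCount (measurableSet_unitCube k) (measurableSet_unitCube l)
        (disjoint_unitCube hkl)).comp (φ := fun n : ℕ => (n : ℝ) ^ 2)
        (ψ := fun n : ℕ => (n : ℝ) ^ 2) (measurable_of_countable _) (measurable_of_countable _)
  have hσ0 : 0 ≤ σ := variance_nonneg _ _
  have hsum : Summable fun n : ℕ =>
      Var[∑ k ∈ cornerBox d (2 ^ n), X k; P] / (((2 : ℝ) * 2 ^ n) ^ d) ^ 2 := by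
    refine Summable.of_nonneg_of_le
      (fun n => div_nonneg (variance_nonneg _ _) (sq_nonneg _)) (fun n => ?_)
      ((summable_geometric_of_lt_one (r := (1 / 2 : ℝ)) (by norm_num) (by norm_num)).mul_left σ)
    have h1 : (2 : ℝ) ^ n ≤ (2 * 2 ^ n) ^ d := by
      have h2 : (1 : ℝ) ≤ 2 ^ n := one_le_pow₀ (by norm_num)
      exact le_trans (by linarith) (le_self_pow₀ (by linarith) (by lia : d ≠ 0))
    have h0 : (0 : ℝ) < (2 * 2 ^ n) ^ d := by positivity
    rw [hvar, div_pow, one_pow, mul_one_div, div_le_div_iff₀ (by positivity) (by positivity)]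
    calc ((2 : ℝ) * 2 ^ n) ^ d * σ * 2 ^ n ≤ (2 * 2 ^ n) ^ d * σ * (2 * 2 ^ n) ^ d := by gcongr
      _ = _ := by ring
  filter_upwards [ae_eventually_abs_sub_integral_lt hmem
    (b := fun n => ((2 : ℝ) * 2 ^ n) ^ d) (fun n => by positivity) hsum] with ξ hξ
  filter_upwards [hξ] with n hn
  rw [hmean] at hn
  have h1 := (abs_lt.1 hn).2
  simp only [Finset.sum_apply, X] at h1
  linarith

theorem ae_isRegular (hd : 1 ≤ d) (hΛ : IsPoissonProcess ρ Λ P) :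
    ∀ᵐ ξ ∂P, (Λ ξ).IsRegular ρ := by
  filter_upwards [hΛ.ae_tendsto_density hd, hΛ.ae_eventually_sum_natCount_sq_le hd] with ξ h1 h2
  exact ⟨h1, fun r => (Λ ξ).exists_nearPairs_le h2 r⟩

end IsPoissonProcess

/-! ### The Fourier transform of a point mass -/

theorem isFourierTransform_dirac {d : ℕ} (ρ : ℝ≥0) :
    IsFourierTransform (RadonMeasure.ofMeasure (ρ • Measure.dirac (0 : Space d)))
      (ρ • volume) := by
  refine ⟨?_, ?_, fun φ => ?_⟩
  · have : (RadonMeasure.ofMeasure (ρ • Measure.dirac (0 : Space d))).variation =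
        ρ • Measure.dirac 0 := by
      simp [RadonMeasure.variation, RadonMeasure.ofMeasure]
    rw [this]
    infer_instance
  · obtain ⟨n, hn⟩ := (inferInstance : (volume : Measure (Space d)).HasTemperateGrowth)
    exact ⟨n, hn.smul_measure_nnreal⟩
  · simp only [RadonMeasure.integral, RadonMeasure.ofMeasure, mul_one]
    rw [integral_smul_nnreal_measure, integral_smul_nnreal_measure, integral_dirac,
      SchwartzMap.fourier_coe, Real.fourier_eq]
    simp

end RandomDiffraction

theorem theorem1 {d : ℕ} (hd : 1 ≤ d) (ρ : ℝ≥0)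
    {Ω : Type*} [MeasurableSpace Ω] (P : Measure Ω) [IsProbabilityMeasure P]
    (Λ : Ω → PointSet d) (hΛ : IsPoissonProcess ρ Λ P) :
    ∀ᵐ ξ ∂P,
      ∀ (Ω' : Type*) [MeasurableSpace Ω'] (P' : Measure Ω') [IsProbabilityMeasure P']
        (W : (Λ ξ).carrier → Ω' → ℝ),
        (∀ x, HasLaw (W x) signLaw P') → iIndepFun W P' →
        ∀ᵐ η ∂P',
          IsAutocorrelation ((Λ ξ).comb fun x => W x η)
              (RadonMeasure.ofMeasure (ρ • Measure.dirac 0)) ∧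
            IsDiffraction ((Λ ξ).comb fun x => W x η) (ρ • volume) := by
  -- Regularity concerns `ξ` alone, so the null set is fixed before any choice of `Ω'`, `P'` and
  -- `W`.
  filter_upwards [hΛ.ae_isRegular hd] with ξ hξ
  intro Ω' _ P' _ W hW hWi
  -- Countability lets the almost sure equalities of `W x` and `V x` hold for all `x`
  -- simultaneously.
  have : Countable (Λ ξ).carrier := (Λ ξ).countable_carrier.to_subtype
  obtain ⟨V, hV, hWV⟩ := exists_isSignFamily hW hWi
  filter_upwards [ae_all_iff.2 hWV, hξ.ae_forall_tendsto_correlation hd hV] with η h1 h2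
  have hauto : IsAutocorrelation ((Λ ξ).comb fun x => W x η)
      (RadonMeasure.ofMeasure (ρ • Measure.dirac 0)) := by
    intro g
    have hint : (RadonMeasure.ofMeasure (ρ • Measure.dirac (0 : Space d))).integral g =
        ρ * g 0 := by
      simp only [RadonMeasure.integral, RadonMeasure.ofMeasure, mul_one]
      rw [integral_smul_nnreal_measure, integral_dirac, NNReal.smul_def, Complex.real_smul]
    rw [hint]
    refine (h2 g).congr fun R => ?_
    rw [PointSet.functionalConv_comb_restrict_ball]
    intro x
    rw [PointSet.extendReal_of_mem _ _ x.2, h1 x]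
  exact ⟨hauto, _, hauto, isFourierTransform_dirac ρ⟩
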